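/- Let $\mathcal S=\mathcal S(S^1\times I;\mathbb Q(A))$ be the Kauffman bracket skein module of the annulus over the field $\mathbb Q(A)$ of rational functions, i.e. the $\mathbb Q(A)$-vector space generated by isotopy classes of framed links in the solid torus $(S^1\times I)\times I$ (including the empty link $\emptyset$; a framed link is given by a diagram in the annulus with its blackboard framing), modulo the relations that replace a crossing by $A$ times its $A$-smoothing plus $A^{-1}$ times its $B$-smoothing, and $L\sqcup\bigcirc=-(A^2+A^{-2})L$ for a trivial circle $\bigcirc$ bounding a disc. Let $z^j\in\mathcal S$ be the class of $j$ parallel copies of the core of the annulus, and let $S_i\in\mathcal S$ be the Chebyshev polynomials in $z$ given by $S_0=1=\emptyset$, $S_1=z$, $S_{i+2}=zS_{i+1}-S_i$. Fix $n\ge 0$. For a link $L$ in the solid torus given by a diagram in the annulus, let $L^n\in\mathcal S$ be obtained by replacing every component by $n$ parallel copies in the diagram and inserting the $n$-th Jones--Wenzl projector $f^{(n)}\in TL_n$ in every component. Then $L^n$ has a unique expansion as a finite linear combination of the $S_i$. Let $$L^n=\sum_{i=0}^{k}\Gamma_i(L)\,S_i,\qquad \Gamma_i(L)\in\mathbb Q(A),\quad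 \Gamma_k(L)\neq 0 .$$ The index $k$ and the ratios $\Gamma_i(L)/\Gamma_k(L)$, $0\le i\le k-1$, are ambient isotopy invariants of $L$: if diagrams of $L$ and $L'$ in the annulus are related by isotopies of the annulus and Reidemeister moves of types I, II and III, then the expansion of $L'^n$ has the same last index $k$ with $\Gamma_k(L')\ne0$, and $$\frac{\Gamma_i(L)}{\Gamma_k(L)}=\frac{\Gamma_i(L')}{\Gamma_k(L')}\qquad\text{for all } 0\le i\le k-1 .$$ -/

import Mathlib

/-!
# Kauffman bracket skein module of the annulus and coloured links in the solid torus

Conventions.  The solid torus is `M = (S¹ × I) × I`, and links in it are given by their diagrams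
in the annulus `S¹ × I`; ambient isotopy of links is the equivalence relation on diagrams generated
by isotopy of the annulus and the Reidemeister moves of types I, II and III, and framed links up to
isotopy are diagrams (with the blackboard framing) up to isotopy of the annulus, moves of types
II and III, and the framed version of the move of type I.

A diagram in the annulus is written in sliced form.  Cut the annulus open along a radius that meets
the diagram transversally in `m` points and avoids crossings; then move the radius once around the
annulus.  After a small isotopy the diagram becomes a finite sequence of elementary slices, each
holding just one local minimum (`cup`), local maximum (`cap`) or crossing of the angular height
function.  Strands are numbered `0, 1, 2, …` across the annulus, and a sequence of slices is read in
the direction of increasing height (pictured upwards, with strand numbers increasing to the right).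
-/

namespace AnnularSkein

/-- The four types of elementary pieces of an unoriented diagram.  In `crossing true` the strand
that runs from the lower left to the upper right passes over, in `crossing false` it passes under. -/
inductive Piece : Type
  | cup : Piece
  | cap : Piece
  | crossing : Bool → Piece

/-- Number of strands that enter a piece from below. -/
def Piece.inputs : Piece → ℕ
  | .cup => 0
  | .cap => 2
  | .crossing _ => 2

/-- Number of strands that leave a piece at the top. -/
def Piece.outputs : Piece → ℕ
  | .cup => 2
  | .cap => 0
  | .crossing _ => 2

/-- An elementary slice: a piece with `pos` vertical strands on its left and any number of vertical
strands on its right. -/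
structure Slice : Type where
  piece : Piece
  pos : ℕ

/-- A local minimum creating the strands `i, i + 1`. -/
def cup (i : ℕ) : Slice := ⟨.cup, i⟩

/-- A local maximum joining the strands `i, i + 1`. -/
def cap (i : ℕ) : Slice := ⟨.cap, i⟩

/-- A crossing of the strands `i, i + 1`. -/
def cross (e : Bool) (i : ℕ) : Slice := ⟨.crossing e, i⟩

/-- `IsTangle p w q`: the slices `w`, read from below, form a tangle diagram in a rectangle with
`p` end points at the bottom and `q` end points at the top. -/
def IsTangle : ℕ → List Slice → ℕ → Prop
  | p, [], q => p = q
  | p, s :: w, q =>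
      s.pos + s.piece.inputs ≤ p ∧ IsTangle (p - s.piece.inputs + s.piece.outputs) w q

/-- A link diagram in the annulus in sliced form: a tangle diagram with `width` end points at the
bottom and at the top, whose top is glued to its bottom around the annulus. -/
@[ext]
structure AnnularDiagram : Type where
  width : ℕ
  word : List Slice
  closed : IsTangle width word width

/-! ### Isotopy -/

/-- The local moves of framed isotopy: isotopy of the plane (pieces at different places are
independent, a zigzag is straightened, a strand beside a crossing turns over), the moves of
types II and III, and the framed move of type I, which exchanges the two curls of equal writhe. -/
inductive FramedLocalMove : List Slice → List Slice → Prop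
  | independent (g h : Piece) (i k : ℕ) :
      FramedLocalMove [⟨g, i⟩, ⟨h, i + g.outputs + k⟩] [⟨h, i + g.inputs + k⟩, ⟨g, i⟩]
  | zigzag_left (i : ℕ) : FramedLocalMove [cup (i + 1), cap i] []
  | zigzag_right (i : ℕ) : FramedLocalMove [cup i, cap (i + 1)] []
  | turn_cup (e : Bool) (i : ℕ) :
      FramedLocalMove [cup i, cross e (i + 1)] [cup (i + 1), cross (!e) i]
  | turn_cap (e : Bool) (i : ℕ) :
      FramedLocalMove [cross e i, cap (i + 1)] [cross (!e) (i + 1), cap i]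
  | type_II (e : Bool) (i : ℕ) : FramedLocalMove [cross e i, cross (!e) i] []
  | type_III (e : Bool) (i : ℕ) :
      FramedLocalMove [cross e i, cross e (i + 1), cross e i]
        [cross e (i + 1), cross e i, cross e (i + 1)]
  | type_I_framed (e : Bool) (i : ℕ) :
      FramedLocalMove [cup (i + 1), cross e i, cap (i + 1)] [cup i, cross e (i + 1), cap i]

/-- The local moves of ambient isotopy: the moves above and the move of type I, which removes
a curl on the right or on the left of a strand. -/
inductive AmbientLocalMove : List Slice → List Slice → Prop
  | framed {l r : List Slice} : FramedLocalMove l r → AmbientLocalMove l r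
  | type_I_right (e : Bool) (i : ℕ) : AmbientLocalMove [cup (i + 1), cross e i, cap (i + 1)] []
  | type_I_left (e : Bool) (i : ℕ) : AmbientLocalMove [cup i, cross e (i + 1), cap i] []

/-- The moves on diagrams in the annulus that come from a set of local moves: a local move is
applied somewhere in the diagram, or the radius along which the annulus is cut open is moved to
another place. -/
inductive AnnularMove (R : List Slice → List Slice → Prop) : AnnularDiagram → AnnularDiagram → Prop
  | in_place {m : ℕ} {u l r v : List Slice} (hlr : R l r)
      (hl : IsTangle m (u ++ l ++ v) m) (hr : IsTangle m (u ++ r ++ v) m) :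
      AnnularMove R ⟨m, u ++ l ++ v, hl⟩ ⟨m, u ++ r ++ v, hr⟩
  | rotate {m p : ℕ} {u v : List Slice} (_hu : IsTangle m u p) (_hv : IsTangle p v m)
      (h : IsTangle m (u ++ v) m) (h' : IsTangle p (v ++ u) p) :
      AnnularMove R ⟨m, u ++ v, h⟩ ⟨p, v ++ u, h'⟩

/-- Two diagrams in the annulus represent ambient isotopic links in the solid torus. -/
def AmbientIsotopic : AnnularDiagram → AnnularDiagram → Prop :=
  Relation.EqvGen (AnnularMove AmbientLocalMove)

/-- Isotopy classes of framed links in the solid torus, including the empty link. -/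
def FramedLink : Type := Quot (AnnularMove FramedLocalMove)

/-- The isotopy class of a diagram with its blackboard framing. -/
def AnnularDiagram.framed (D : AnnularDiagram) : FramedLink := Quot.mk _ D

noncomputable section

/-! ### The skein module of the annulus -/

/-- The field `ℚ(A)` of rational functions in the indeterminate `A`. -/
abbrev K : Type := RatFunc ℚ

/-- The indeterminate `A`. -/
def A : K := RatFunc.X

/-- The value `-A² - A⁻²` of a trivial circle. -/
def loopValue : K := -A ^ 2 - A⁻¹ ^ 2

/-- The free vector space on the isotopy classes of framed links. -/
abbrev FreeSkein : Type := FramedLink →₀ K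

/-- A framed link as a generator of the free vector space. -/
def gen (D : AnnularDiagram) : FreeSkein := Finsupp.single D.framed 1

/-- The Kauffman bracket relations: the resolution of a crossing (for a crossing in either of its
two positions with respect to the height function) and the removal of a trivial circle. -/
inductive SkeinRelator : FreeSkein → Prop
  | crossing_true {m i : ℕ} {u v : List Slice} (hx : IsTangle m (u ++ [cross true i] ++ v) m)
      (h0 : IsTangle m (u ++ v) m) (h1 : IsTangle m (u ++ [cap i, cup i] ++ v) m) :
      SkeinRelator (gen ⟨m, _, hx⟩ - A • gen ⟨m, _, h0⟩ - A⁻¹ • gen ⟨m, _, h1⟩)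
  | crossing_false {m i : ℕ} {u v : List Slice} (hx : IsTangle m (u ++ [cross false i] ++ v) m)
      (h0 : IsTangle m (u ++ v) m) (h1 : IsTangle m (u ++ [cap i, cup i] ++ v) m) :
      SkeinRelator (gen ⟨m, _, hx⟩ - A • gen ⟨m, _, h1⟩ - A⁻¹ • gen ⟨m, _, h0⟩)
  | circle {m i : ℕ} {u v : List Slice} (hc : IsTangle m (u ++ [cup i, cap i] ++ v) m)
      (h0 : IsTangle m (u ++ v) m) :
      SkeinRelator (gen ⟨m, _, hc⟩ + (A ^ 2 + A⁻¹ ^ 2) • gen ⟨m, _, h0⟩)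

/-- The Kauffman bracket skein module of the annulus over `ℚ(A)`. -/
abbrev Skein : Type := FreeSkein ⧸ Submodule.span K {x : FreeSkein | SkeinRelator x}

/-- The class of a diagram in the skein module. -/
def AnnularDiagram.bracket (D : AnnularDiagram) : Skein := Submodule.Quotient.mk (gen D)

/-- The diagram `zʲ`: `j` parallel copies of the core of the annulus. -/
def coreParallel (j : ℕ) : AnnularDiagram := ⟨j, [], rfl⟩

/-- The element `S_i` of the skein module: the Chebyshev polynomial determined by `S_0 = 1`,
`S_1 = z`, `S_(i+2) = z S_(i+1) - S_i`, evaluated at the core `z`. -/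
def chebyshevElement (i : ℕ) : Skein :=
  (Polynomial.Chebyshev.S K (i : ℤ)).sum fun j c => c • (coreParallel j).bracket

/-! ### Linear combinations of tangles and the Jones-Wenzl projectors -/

/-- Formal linear combinations of sequences of slices; the product is vertical juxtaposition, with
the first factor at the bottom. A tangle with `p` strands at the bottom is also used, unchanged, as
the tangle with further vertical strands on its right. -/
abbrev Formal : Type := MonoidAlgebra K (FreeMonoid Slice)

/-- A sequence of slices as a formal linear combination. -/
def ofWord (w : List Slice) : Formal := MonoidAlgebra.of K (FreeMonoid Slice) (FreeMonoid.ofList w)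

/-- Place `k` vertical strands on the left. -/
def shift (k : ℕ) : Formal →+* Formal :=
  MonoidAlgebra.mapDomainRingHom K
    (FreeMonoid.map fun s : Slice => (⟨s.piece, k + s.pos⟩ : Slice))

/-- The value `Δ_n = S_n(-A² - A⁻²)` of the closure of the `n`-th Jones-Wenzl projector in the
plane. -/
def Delta (n : ℕ) : K := (Polynomial.Chebyshev.S K (n : ℤ)).eval loopValue

/-- The `n`-th Jones-Wenzl projector `f⁽ⁿ⁾` of the Temperley-Lieb algebra on `n` strands, by the
recursion `f⁽ⁿ⁺¹⁾ = f⁽ⁿ⁾ - (Δ_(n-1) / Δ_n) f⁽ⁿ⁾ e_n f⁽ⁿ⁾`, in which `f⁽ⁿ⁾` on the right has one more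
vertical strand and `e_n` is the hook on the last two of the `n + 1` strands. -/
def jonesWenzl : ℕ → Formal
  | 0 => 1
  | 1 => 1
  | n + 2 => jonesWenzl (n + 1) -
      (Delta n / Delta (n + 1)) • (jonesWenzl (n + 1) * ofWord [cap n, cup n] * jonesWenzl (n + 1))

/-- The sum of `c • (closure of w around the annulus)` over the terms `c • w` of a linear
combination of tangles with `m` end points at the bottom and `m` at the top.
(Terms that are not such tangles contribute `0`.) -/
def closure (m : ℕ) (x : Formal) : Skein :=
  open Classical in
  x.coeff.sum fun w c =>
    if h : IsTangle m w.toList m then c • (AnnularDiagram.mk m w.toList h).bracket else 0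

/-! ### Coloured diagrams -/

/-- A slice with every strand replaced by `n` parallel strands: `n` nested minima, `n` nested
maxima, or the `n²` crossings of `n` parallel strands with `n` parallel strands. -/
def cable (n : ℕ) : Slice → List Slice
  | ⟨.cup, i⟩ => (List.range n).map fun a => cup (n * i + a)
  | ⟨.cap, i⟩ => ((List.range n).map fun a => cap (n * i + a)).reverse
  | ⟨.crossing e, i⟩ =>
      (List.range n).reverse.flatMap fun a => (List.range n).map fun b => cross e (n * i + a + b)

/-- `p` bands of `n` strands side by side, with `f⁽ⁿ⁾` inserted in each band. -/
def projectorRow (n p : ℕ) : Formal :=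
  ((List.range p).map fun j => shift (n * j) (jonesWenzl n)).prod

/-- A tangle with `p` end points at the bottom, with every strand replaced by `n` parallel strands
and `f⁽ⁿ⁾` inserted in every band at every level between the slices. Since `f⁽ⁿ⁾` is
idempotent and moves freely along a band, this is the tangle with one `f⁽ⁿ⁾` on each component. -/
def coloredTangle (n : ℕ) : ℕ → List Slice → Formal
  | p, [] => projectorRow n p
  | p, s :: w => projectorRow n p * ofWord (cable n s) *
      coloredTangle n (p - s.piece.inputs + s.piece.outputs) w

/-- The skein element `Lⁿ`: all components of the link with diagram `D` are coloured with the
`n`-th Jones-Wenzl projector. -/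
def AnnularDiagram.colored (n : ℕ) (D : AnnularDiagram) : Skein :=
  closure (n * D.width) (coloredTangle n D.width D.word)

/-- `Γ` is the sequence of coefficients of the expansion of `D.colored n` in the elements `S_i`. -/
def IsChebyshevExpansion (n : ℕ) (D : AnnularDiagram) (Γ : ℕ →₀ K) : Prop :=
  D.colored n = Γ.sum fun i c => c • chebyshevElement i

/-- `k` is the last index of the expansion: `Γ = (Γ_0, …, Γ_k, 0, 0, …)` with `Γ_k ≠ 0`. -/
def IsLastIndex (Γ : ℕ →₀ K) (k : ℕ) : Prop :=
  Γ k ≠ 0 ∧ ∀ i, k < i → Γ i = 0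

end

end AnnularSkein

namespace AnnularSkein
noncomputable section

/-! ### Representations of the category of planar tangles -/

/-! Ambient isotopy changes `Lⁿ` only by a nonzero scalar. Framed isotopy does not change it at all,
and a curl on a band that carries `f⁽ⁿ⁾` costs a factor, because `f⁽ⁿ⁾ y f⁽ⁿ⁾` is a multiple of
`f⁽ⁿ⁾` for every tangle `y` on `n` strands. Since the `S_i` form a basis of the skein module,
isotopic diagrams have proportional coefficient sequences, hence the same last index and the same
ratios.

The basis: every tangle reduces to one whose maxima lie below its minima (`ofWord_mem_reducible`),
and moving the cut to the narrow level in between shows that the powers `zʲ` span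
(`bracket_mem_span`). For independence, tangles act on sequences of two-valued spins (`spinRep`,
modelled on the fundamental representation of quantum `sl₂`). Minima and maxima create and absorb
opposite spins, so a trace weighted by `t` or `t⁻¹` per spin is cyclic. It gives for each `t ≠ 0` a
functional `skeinTrace` with `zʲ ↦ (t + t⁻¹)ʲ`. Therefore `evalCore` identifies `K[z]` with the
skein module, and the functionals separate its elements (`skein_ext`).

Identities between closures may thus be checked inside `spinRep`, and the local computations are
made in an arbitrary `TLRep`. Cabled slices satisfy the same moves as slices, except the removal of
curls. The projector slides through crossings (`band_mul_cross_left`, `band_mul_cross_right`) and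
around minima and maxima (`cup_mul_band`, `band_mul_cap`), so the superfluous projectors in
`coloredTangle` can be dropped (`colored_pair`, `colored_curl`). By `exists_curl_scalar` left and
right curls have the same factor, which the framed move of type I needs, and it is nonzero, which
makes proportionality symmetric: placed on a minimum, both curls turn into the same invertible
crossing. -/

/-- Elements `c i` (a minimum at position `i`) and `d i` (a maximum at position `i`) of an algebra,
subject to planar isotopy and the circle relation, with infinitely many strands on the right. -/
structure TLRep (R : Type) [Ring R] [Algebra K R] where
  c : ℕ → R
  d : ℕ → R
  cc : ∀ i k, c i * c (i + 2 + k) = c (i + k) * c i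
  cd : ∀ i k, c i * d (i + 2 + k) = d (i + k) * c i
  dc : ∀ i k, d i * c (i + k) = c (i + 2 + k) * d i
  dd : ∀ i k, d i * d (i + k) = d (i + 2 + k) * d i
  zigzag_left : ∀ i, c (i + 1) * d i = 1
  zigzag_right : ∀ i, c i * d (i + 1) = 1
  loop : ∀ i, c i * d i = loopValue • 1

theorem A_ne_zero : A ≠ 0 := RatFunc.X_ne_zero

/-- The coefficient of the vertical smoothing in the resolution of a crossing. -/
def smoothCoeff (e : Bool) : K := if e then A else A⁻¹

theorem smoothCoeff_mul_not (e : Bool) : smoothCoeff e * smoothCoeff (!e) = 1 := by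
  cases e <;> simp [smoothCoeff, A_ne_zero]

theorem loopValue_eq (e : Bool) :
    loopValue = - smoothCoeff e ^ 2 - smoothCoeff (!e) ^ 2 := by
  cases e <;> simp [smoothCoeff, loopValue]; ring

namespace TLRep

variable {R : Type} [Ring R] [Algebra K R] (T : TLRep R)

/-- The hook on the strands `i, i + 1`. -/
def u (i : ℕ) : R := T.d i * T.c i

/-- The crossing of the strands `i, i + 1`. -/
def x (e : Bool) (i : ℕ) : R := smoothCoeff e • 1 + smoothCoeff (!e) • T.u i

/-- The image of a slice. -/
def slice : Slice → R
  | ⟨.cup, i⟩ => T.c i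
  | ⟨.cap, i⟩ => T.d i
  | ⟨.crossing e, i⟩ => T.x e i

/-- The image of a sequence of slices. -/
def word (w : List Slice) : R := (w.map T.slice).prod

@[simp] theorem word_nil : T.word [] = 1 := rfl

@[simp] theorem word_cons (s : Slice) (w : List Slice) :
    T.word (s :: w) = T.slice s * T.word w := by simp [word]

@[simp] theorem word_append (v w : List Slice) : T.word (v ++ w) = T.word v * T.word w := by
  simp [word]

@[simp] theorem slice_cup (i : ℕ) : T.slice (cup i) = T.c i := rfl
@[simp] theorem slice_cap (i : ℕ) : T.slice (cap i) = T.d i := rfl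
@[simp] theorem slice_cross (e : Bool) (i : ℕ) : T.slice (cross e i) = T.x e i := rfl

/-- The image of a formal linear combination of sequences of slices. -/
def eval : Formal →ₐ[K] R := MonoidAlgebra.lift K R (FreeMonoid Slice) (FreeMonoid.lift T.slice)

@[simp] theorem eval_ofWord (w : List Slice) : T.eval (ofWord w) = T.word w := by
  simp [eval, ofWord, word, FreeMonoid.lift_apply]

/-- All positions moved by `N` to the right. -/
@[simps] def shift (N : ℕ) : TLRep R where
  c i := T.c (N + i)
  d i := T.d (N + i)
  cc i k := by simpa [add_assoc] using T.cc (N + i) k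
  cd i k := by simpa [add_assoc] using T.cd (N + i) k
  dc i k := by simpa [add_assoc] using T.dc (N + i) k
  dd i k := by simpa [add_assoc] using T.dd (N + i) k
  zigzag_left i := T.zigzag_left (N + i)
  zigzag_right i := T.zigzag_right (N + i)
  loop i := T.loop (N + i)

/-- The reflection in a horizontal line. -/
@[simps] def dual : TLRep Rᵐᵒᵖ where
  c i := MulOpposite.op (T.d i)
  d i := MulOpposite.op (T.c i)
  cc i k := by simp only [← MulOpposite.op_mul, T.dd]
  cd i k := by rw [← MulOpposite.op_mul, ← MulOpposite.op_mul, T.dc]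
  dc i k := by rw [← MulOpposite.op_mul, ← MulOpposite.op_mul, T.cd]
  dd i k := by simp only [← MulOpposite.op_mul, T.cc]
  zigzag_left i := by simp only [← MulOpposite.op_mul, T.zigzag_right]; rfl
  zigzag_right i := by simp only [← MulOpposite.op_mul, T.zigzag_left]; rfl
  loop i := by simp only [← MulOpposite.op_mul, T.loop]; rfl

@[simp] theorem shift_u (N i : ℕ) : (T.shift N).u i = T.u (N + i) := rfl
@[simp] theorem shift_x (N : ℕ) (e : Bool) (i : ℕ) : (T.shift N).x e i = T.x e (N + i) := rfl
@[simp] theorem dual_u (i : ℕ) : T.dual.u i = MulOpposite.op (T.u i) := rfl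
@[simp] theorem dual_x (e : Bool) (i : ℕ) : T.dual.x e i = MulOpposite.op (T.x e i) := rfl

end TLRep

/-! ### Words of slices, formal combinations and shifts of position. -/

/-- A slice with `k` further vertical strands on its left. -/
def Slice.shift (k : ℕ) (s : Slice) : Slice := ⟨s.piece, k + s.pos⟩

@[simp] theorem shift_cup (k i : ℕ) : (cup i).shift k = cup (k + i) := rfl
@[simp] theorem shift_cap (k i : ℕ) : (cap i).shift k = cap (k + i) := rfl
@[simp] theorem shift_cross (k : ℕ) (e : Bool) (i : ℕ) :
    (cross e i).shift k = cross e (k + i) := rfl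

theorem ofWord_append (v w : List Slice) : ofWord (v ++ w) = ofWord v * ofWord w := by
  simp [ofWord, MonoidAlgebra.single_mul_single]

theorem shift_ofWord (k : ℕ) (w : List Slice) :
    shift k (ofWord w) = ofWord (w.map (Slice.shift k)) := by
  simp [shift, ofWord, MonoidAlgebra.mapDomainRingHom]
  rfl

theorem smul_ofWord_eq_single (a : K) (w : FreeMonoid Slice) :
    (MonoidAlgebra.single w a : Formal) = a • ofWord w.toList := by
  simp [ofWord]

theorem shift_smul (k : ℕ) (a : K) (x : Formal) : shift k (a • x) = a • shift k x := by
  simp [shift, MonoidAlgebra.mapDomainRingHom, MonoidAlgebra.mapDomain_smul]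

theorem Formal.induction {P : Formal → Prop} (x : Formal) (zero : P 0)
    (add : ∀ x y, P x → P y → P (x + y)) (word : ∀ (a : K) w, P (a • ofWord w)) : P x :=
  MonoidAlgebra.induction_linear x zero add fun w a => by
    rw [smul_ofWord_eq_single]; exact word a _

namespace TLRep

variable {R : Type} [Ring R] [Algebra K R] (T : TLRep R)

theorem slice_shift (N : ℕ) (s : Slice) : T.slice (s.shift N) = (T.shift N).slice s := by
  rcases s with ⟨_ | _ | e, i⟩ <;> rfl

theorem word_shift (N : ℕ) (w : List Slice) :
    T.word (w.map (Slice.shift N)) = (T.shift N).word w := by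
  induction w with
  | nil => rfl
  | cons s w ih => simp [ih, slice_shift]

theorem eval_shift (N : ℕ) (y : Formal) : T.eval (AnnularSkein.shift N y) = (T.shift N).eval y := by
  induction y using Formal.induction with
  | zero => simp
  | add x y hx hy => simp [hx, hy]
  | word a w => rw [shift_smul, map_smul, map_smul, shift_ofWord]; simp [word_shift]

end TLRep

/-! ### Tangles -/

theorem isTangle_append {p q : ℕ} {v w : List Slice} :
    IsTangle p (v ++ w) q ↔ ∃ r, IsTangle p v r ∧ IsTangle r w q := by
  induction v generalizing p with
  | nil => simp [IsTangle]
  | cons s v ih => simp [IsTangle, ih, and_assoc]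

theorem IsTangle.append {p q r : ℕ} {v w : List Slice} (hv : IsTangle p v q) (hw : IsTangle q w r) :
    IsTangle p (v ++ w) r := isTangle_append.2 ⟨q, hv, hw⟩

theorem IsTangle.unique {p q q' : ℕ} {w : List Slice} (h : IsTangle p w q) (h' : IsTangle p w q') :
    q = q' := by
  induction w generalizing p with
  | nil => exact h.symm.trans h'
  | cons s w ih => exact ih h.2 h'.2

theorem IsTangle.mono {p q : ℕ} {w : List Slice} (h : IsTangle p w q) (k : ℕ) :
    IsTangle (p + k) w (q + k) := by
  induction w generalizing p with
  | nil => simpa [IsTangle] using h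
  | cons s w ih =>
    refine ⟨by have := h.1; omega, ?_⟩
    have := ih h.2
    rwa [show p + k - s.piece.inputs + s.piece.outputs = p - s.piece.inputs + s.piece.outputs + k by
      have := h.1; omega]

theorem IsTangle.shift {p q : ℕ} {w : List Slice} (h : IsTangle p w q) (k : ℕ) :
    IsTangle (k + p) (w.map (Slice.shift k)) (k + q) := by
  induction w generalizing p with
  | nil => simpa [IsTangle] using h
  | cons s w ih =>
    refine ⟨by have := h.1; simp [Slice.shift]; omega, ?_⟩
    have := ih h.2
    rwa [show k + (p - s.piece.inputs + s.piece.outputs) =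
      k + p - s.piece.inputs + s.piece.outputs by have := h.1; omega] at this

/-- The linear combinations of tangles with `p` end points at the bottom and `q` at the top. -/
def tangles (p q : ℕ) : Submodule K Formal :=
  Submodule.span K {y | ∃ w, IsTangle p w q ∧ y = ofWord w}

theorem ofWord_mem_tangles {p q : ℕ} {w : List Slice} (h : IsTangle p w q) :
    ofWord w ∈ tangles p q := Submodule.subset_span ⟨w, h, rfl⟩

theorem one_mem_tangles (p : ℕ) : (1 : Formal) ∈ tangles p p :=
  ofWord_mem_tangles (w := []) rfl

theorem mul_mem_tangles {p q r : ℕ} {y z : Formal} (hy : y ∈ tangles p q) (hz : z ∈ tangles q r) :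
    y * z ∈ tangles p r := by
  induction hy using Submodule.span_induction with
  | mem y h =>
    obtain ⟨v, hv, rfl⟩ := h
    induction hz using Submodule.span_induction with
    | mem z h =>
      obtain ⟨w, hw, rfl⟩ := h
      rw [← ofWord_append]
      exact ofWord_mem_tangles (hv.append hw)
    | zero => simp
    | add a b _ _ ha hb => rw [mul_add]; exact add_mem ha hb
    | smul a b _ hb => rw [mul_smul_comm]; exact Submodule.smul_mem _ _ hb
  | zero => simp
  | add a b _ _ ha hb => rw [add_mul]; exact add_mem ha hb
  | smul a b _ hb => rw [smul_mul_assoc]; exact Submodule.smul_mem _ _ hb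

theorem tangles_mono {p q : ℕ} {y : Formal} (hy : y ∈ tangles p q) (k : ℕ) :
    y ∈ tangles (p + k) (q + k) := by
  refine (Submodule.span_le (p := tangles (p + k) (q + k))).2 ?_ hy
  rintro _ ⟨w, hw, rfl⟩
  exact ofWord_mem_tangles (hw.mono k)

theorem shift_mem_tangles {p q : ℕ} {y : Formal} (hy : y ∈ tangles p q) (k : ℕ) :
    shift k y ∈ tangles (k + p) (k + q) := by
  induction hy using Submodule.span_induction with
  | mem y h =>
    obtain ⟨w, hw, rfl⟩ := h
    rw [shift_ofWord]
    exact ofWord_mem_tangles (hw.shift k)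
  | zero => simp
  | add a b _ _ ha hb => rw [map_add]; exact add_mem ha hb
  | smul a b _ hb => rw [shift_smul]; exact Submodule.smul_mem _ _ hb

/-! ### Local relations in a representation -/

namespace TLRep

variable {R : Type} [Ring R] [Algebra K R] (T : TLRep R)

/-- The exchange axioms for minima and maxima pass to hooks, which are products of the two, and then
to crossings, which are combinations of `1` and a hook. -/
theorem slice_far (g h : Piece) (i k : ℕ) :
    T.slice ⟨g, i⟩ * T.slice ⟨h, i + g.outputs + k⟩ =
      T.slice ⟨h, i + g.inputs + k⟩ * T.slice ⟨g, i⟩ := by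
  have hc : ∀ i k, T.c i * T.u (i + 2 + k) = T.u (i + k) * T.c i := fun i k => by
    rw [u, u, ← mul_assoc, T.cd, mul_assoc, T.cc, mul_assoc]
  have hd : ∀ i k, T.d i * T.u (i + k) = T.u (i + 2 + k) * T.d i := fun i k => by
    rw [u, u, ← mul_assoc, T.dd, mul_assoc, T.dc, mul_assoc]
  have huc : ∀ i k, T.u i * T.c (i + 2 + k) = T.c (i + 2 + k) * T.u i := fun i k => by
    rw [u, mul_assoc, T.cc, ← mul_assoc, T.dc, mul_assoc]
  have hud : ∀ i k, T.u i * T.d (i + 2 + k) = T.d (i + 2 + k) * T.u i := fun i k => by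
    rw [u, mul_assoc, T.cd, ← mul_assoc, T.dd, mul_assoc]
  have huu : ∀ i k, T.u i * T.u (i + 2 + k) = T.u (i + 2 + k) * T.u i := fun i k => by
    rw [show T.u i = T.d i * T.c i from rfl, mul_assoc, hc, ← mul_assoc, hd, mul_assoc]
  rcases g with _ | _ | e <;> rcases h with _ | _ | e' <;>
    simp only [slice, Piece.outputs, Piece.inputs, add_zero, x, mul_add, add_mul, mul_one, one_mul,
      mul_smul_comm, smul_mul_assoc, T.cc, T.cd, T.dc, T.dd, hc, hd, huc, hud, huu]
  simp only [smul_add, smul_comm (smoothCoeff e'), smul_comm (smoothCoeff !e')]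
  abel

/-- Between the outermost maximum and minimum the product consists of two zigzags. -/
theorem u_mul_u_succ_mul_u (i : ℕ) : T.u i * T.u (i + 1) * T.u i = T.u i := by
  have h : T.u i * T.u (i + 1) * T.u i =
      T.d i * ((T.c i * T.d (i + 1)) * (T.c (i + 1) * T.d i)) * T.c i := by
    simp only [u, mul_assoc]
  rw [h, T.zigzag_right, T.zigzag_left, one_mul, mul_one, u]

theorem u_succ_mul_u_mul_u_succ (i : ℕ) : T.u (i + 1) * T.u i * T.u (i + 1) = T.u (i + 1) := by
  have h : T.u (i + 1) * T.u i * T.u (i + 1) =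
      T.d (i + 1) * ((T.c (i + 1) * T.d i) * (T.c i * T.d (i + 1))) * T.c (i + 1) := by
    simp only [u, mul_assoc]
  rw [h, T.zigzag_right, T.zigzag_left, one_mul, mul_one, u]

theorem u_mul_u (i : ℕ) : T.u i * T.u i = loopValue • T.u i := by
  have h : T.u i * T.u i = T.d i * (T.c i * T.d i) * T.c i := by simp only [u, mul_assoc]
  rw [h, T.loop, mul_smul_comm, mul_one, smul_mul_assoc, u]

theorem c_mul_u_succ (i : ℕ) : T.c i * T.u (i + 1) = T.c (i + 1) := by
  rw [u, ← mul_assoc, T.zigzag_right, one_mul]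

theorem c_succ_mul_u (i : ℕ) : T.c (i + 1) * T.u i = T.c i := by
  rw [u, ← mul_assoc, T.zigzag_left, one_mul]

theorem u_succ_mul_d (i : ℕ) : T.u (i + 1) * T.d i = T.d (i + 1) := by
  rw [u, mul_assoc, T.zigzag_left, mul_one]

theorem u_mul_d_succ (i : ℕ) : T.u i * T.d (i + 1) = T.d i := by
  rw [u, mul_assoc, T.zigzag_right, mul_one]

/-- On a minimum the two smoothings trade roles when the crossing passes from one leg to the other;
this is why `e` becomes `!e`. -/
theorem turn_cup (e : Bool) (i : ℕ) : T.c i * T.x e (i + 1) = T.c (i + 1) * T.x (!e) i := by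
  simp only [x, mul_add, mul_smul_comm, mul_one, c_mul_u_succ, c_succ_mul_u, Bool.not_not]
  exact add_comm _ _

theorem turn_cap (e : Bool) (i : ℕ) : T.x e i * T.d (i + 1) = T.x (!e) (i + 1) * T.d i := by
  simp only [x, add_mul, smul_mul_assoc, one_mul, u_mul_d_succ, u_succ_mul_d, Bool.not_not]
  exact add_comm _ _

/-- The coefficient of `z` on the left is `(a ^ 2 + b ^ 2) * (1 - a * b)`; the circle value is what
makes it vanish. -/
theorem module_type_II {F V : Type} [Field F] [AddCommGroup V] [Module F V] {a b : F}
    (h : a * b = 1) (y z : V) :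
    b • (a • y + b • z) + a • (a • z + b • (-a ^ 2 - b ^ 2) • z) = y := by
  linear_combination (norm := module) h • (y - (a ^ 2 + b ^ 2) • z)

/-- The two sides differ by `b * (a ^ 2 + b ^ 2) * (1 - a * b)` times `y - z`; all other terms
cancel formally. -/
theorem module_type_III {F V : Type} [Field F] [AddCommGroup V] [Module F V] {a b : F}
    (h : a * b = 1) (o y z yz zy : V) :
    a • (a • (a • o + b • y) + b • (a • z + b • yz)) +
        b • (a • (a • y + b • (-a ^ 2 - b ^ 2) • y) + b • (a • zy + b • y)) =
      a • (a • (a • o + b • z) + b • (a • y + b • zy)) +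
        b • (a • (a • z + b • (-a ^ 2 - b ^ 2) • z) + b • (a • yz + b • z)) := by
  linear_combination (norm := module) (-(b * (a ^ 2 + b ^ 2)) * h) • (y - z)

theorem type_II (e : Bool) (i : ℕ) : T.x e i * T.x (!e) i = 1 := by
  have h := smoothCoeff_mul_not e
  have hl := loopValue_eq e
  simp only [x, mul_add, add_mul, smul_mul_assoc, mul_smul_comm, one_mul, mul_one, Bool.not_not,
    u_mul_u, hl]
  exact module_type_II h _ _

theorem type_III (e : Bool) (i : ℕ) :
    T.x e i * T.x e (i + 1) * T.x e i = T.x e (i + 1) * T.x e i * T.x e (i + 1) := by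
  have h := smoothCoeff_mul_not e
  have hl := loopValue_eq e
  simp only [x, mul_add, add_mul, smul_mul_assoc, mul_smul_comm, one_mul, mul_one, u_mul_u, hl,
    u_mul_u_succ_mul_u, u_succ_mul_u_mul_u_succ]
  exact module_type_III h _ _ _ _ _

theorem type_I_framed (e : Bool) (i : ℕ) :
    T.c (i + 1) * T.x e i * T.d (i + 1) = T.c i * T.x e (i + 1) * T.d i := by
  simp only [x, mul_add, add_mul, mul_smul_comm, smul_mul_assoc, mul_one, c_mul_u_succ,
    c_succ_mul_u, T.loop, T.zigzag_left, T.zigzag_right]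

end TLRep

/-! ### Reduction of tangles to normal form -/

/-- The skein relations between tangles with `p` end points at the bottom and `q` at the top. -/
inductive LocalRelator (p q : ℕ) : Formal → Prop
  | move {u l r v : List Slice} (hlr : FramedLocalMove l r) (hl : IsTangle p (u ++ l ++ v) q)
      (hr : IsTangle p (u ++ r ++ v) q) :
      LocalRelator p q (ofWord (u ++ l ++ v) - ofWord (u ++ r ++ v))
  | crossing {e : Bool} {i : ℕ} {u v : List Slice} (hx : IsTangle p (u ++ [cross e i] ++ v) q)
      (h0 : IsTangle p (u ++ v) q) (h1 : IsTangle p (u ++ [cap i, cup i] ++ v) q) :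
      LocalRelator p q (ofWord (u ++ [cross e i] ++ v) - smoothCoeff e • ofWord (u ++ v)
        - smoothCoeff (!e) • ofWord (u ++ [cap i, cup i] ++ v))
  | circle {i : ℕ} {u v : List Slice} (hc : IsTangle p (u ++ [cup i, cap i] ++ v) q)
      (h0 : IsTangle p (u ++ v) q) :
      LocalRelator p q (ofWord (u ++ [cup i, cap i] ++ v) - loopValue • ofWord (u ++ v))

/-- A sequence of slices without crossings in which all maxima are below all minima. -/
def IsNormal (w : List Slice) : Prop :=
  ∃ a b : List Slice, w = a ++ b ∧ (∀ s ∈ a, ∃ i, s = cap i) ∧ ∀ s ∈ b, ∃ i, s = cup i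

/-- The span of the skein relations and the tangles in normal form. -/
def reducible (p q : ℕ) : Submodule K Formal :=
  Submodule.span K {y | LocalRelator p q y} ⊔
    Submodule.span K {y | ∃ w, IsTangle p w q ∧ IsNormal w ∧ y = ofWord w}

/-- A measure of complexity that decreases in the reduction to normal form. -/
def complexity : List Slice → ℕ
  | [] => 0
  | ⟨.cup, _⟩ :: w => 2 * complexity w + 1
  | ⟨.cap, _⟩ :: w => complexity w + 1
  | ⟨.crossing _, _⟩ :: w => 2 * complexity w + 3

theorem complexity_append_lt (u : List Slice) {v w : List Slice}
    (h : complexity v < complexity w) : complexity (u ++ v) < complexity (u ++ w) := by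
  induction u with
  | nil => exact h
  | cons s u ih => rcases s with ⟨_ | _ | e, i⟩ <;> simp only [List.cons_append, complexity] <;> omega

theorem isNormal_or_reducible (w : List Slice) : IsNormal w ∨
    (∃ u e i v, w = u ++ [cross e i] ++ v) ∨ ∃ u i j v, w = u ++ [cup i, cap j] ++ v := by
  induction w with
  | nil => exact Or.inl ⟨[], [], by simp⟩
  | cons s w ih =>
    rcases ih with ⟨a, b, rfl, ha, hb⟩ | ⟨u, e, i, v, rfl⟩ | ⟨u, i, j, v, rfl⟩
    · rcases s with ⟨_ | _ | e, i⟩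
      · rcases a with _ | ⟨t, a⟩
        · left
          refine ⟨[], cup i :: b, rfl, by simp, ?_⟩
          rintro t (_ | ⟨_, ht⟩)
          exacts [⟨i, rfl⟩, hb t ht]
        · obtain ⟨j, rfl⟩ := ha t (by simp)
          exact Or.inr (Or.inr ⟨[], i, j, a ++ b, rfl⟩)
      · left
        refine ⟨cap i :: a, b, rfl, ?_, hb⟩
        rintro t (_ | ⟨_, ht⟩)
        exacts [⟨i, rfl⟩, ha t ht]
      · exact Or.inr (Or.inl ⟨[], e, i, a ++ b, rfl⟩)
    · exact Or.inr (Or.inl ⟨s :: u, e, i, v, rfl⟩)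
    · exact Or.inr (Or.inr ⟨s :: u, i, j, v, rfl⟩)

theorem IsTangle.replace {p q : ℕ} {u l r v : List Slice}
    (H : ∀ p q, IsTangle p l q → IsTangle p r q) (h : IsTangle p (u ++ l ++ v) q) :
    IsTangle p (u ++ r ++ v) q := by
  obtain ⟨t, ht, hv⟩ := isTangle_append.1 h
  obtain ⟨s, hu, hl⟩ := isTangle_append.1 ht
  exact (hu.append (H _ _ hl)).append hv

theorem isTangle_cup_cap {p q i j : ℕ} :
    IsTangle p [cup i, cap j] q ↔ i ≤ p ∧ j ≤ p ∧ p = q := by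
  simp only [IsTangle, cup, cap, Piece.inputs, Piece.outputs]
  omega

theorem isTangle_cap_cup {p q i j : ℕ} :
    IsTangle p [cap i, cup j] q ↔ i + 2 ≤ p ∧ j + 2 ≤ p ∧ p = q := by
  simp only [IsTangle, cup, cap, Piece.inputs, Piece.outputs]
  omega

/-- A minimum directly below a maximum is moved above it or cancelled. -/
theorem cup_cap_cases (i j : ℕ) :
    i = j ∨ FramedLocalMove [cup i, cap j] [] ∨ ∃ i' j',
      (FramedLocalMove [cup i, cap j] [cap j', cup i'] ∨
        FramedLocalMove [cap j', cup i'] [cup i, cap j]) ∧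
      ∀ p q, IsTangle p [cup i, cap j] q → IsTangle p [cap j', cup i'] q := by
  rcases lt_trichotomy i j with h | h | h
  · rcases eq_or_lt_of_le (Nat.succ_le_of_lt h) with rfl | h
    · exact Or.inr (Or.inl (.zigzag_right i))
    · obtain ⟨k, rfl⟩ := Nat.exists_eq_add_of_le (show i + 2 ≤ j from h)
      refine Or.inr (Or.inr ⟨i, i + k, Or.inl (.independent .cup .cap i k), fun p q => ?_⟩)
      rw [isTangle_cup_cap, isTangle_cap_cup]
      omega
  · exact Or.inl h
  · rcases eq_or_lt_of_le (Nat.succ_le_of_lt h) with rfl | h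
    · exact Or.inr (Or.inl (.zigzag_left j))
    · obtain ⟨k, rfl⟩ := Nat.exists_eq_add_of_le (show j + 2 ≤ i from h)
      refine Or.inr (Or.inr ⟨j + k, j, Or.inr (.independent .cap .cup j k), fun p q => ?_⟩)
      rw [isTangle_cup_cap, isTangle_cap_cup]
      omega

/-- If `c` is the complexity of the slices above, a crossing contributes `2c + 3`, a maximum
followed by a minimum `2c + 2`, and a minimum followed by a maximum `2c + 3`. So resolving a
crossing, removing a circle or zigzag, and moving a maximum below a minimum all lower the
complexity, whatever lies below. -/
theorem ofWord_mem_reducible {p q : ℕ} {w : List Slice} (h : IsTangle p w q) :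
    ofWord w ∈ reducible p q := by
  induction hn : complexity w using Nat.strong_induction_on generalizing w with
  | _ n ih =>
    have rel : ∀ {y}, LocalRelator p q y → y ∈ reducible p q := fun hy =>
      Submodule.mem_sup_left (Submodule.subset_span hy)
    rcases isNormal_or_reducible w with hw | ⟨u, e, i, v, rfl⟩ | ⟨u, i, j, v, rfl⟩
    · exact Submodule.mem_sup_right (Submodule.subset_span ⟨w, h, hw, rfl⟩)
    · have h0 : IsTangle p (u ++ v) q := by
        have := h.replace (r := []) fun p q h => by
          simp only [IsTangle, cross, Piece.inputs, Piece.outputs] at *; omega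
        simpa using this
      have h1 : IsTangle p (u ++ [cap i, cup i] ++ v) q := h.replace fun p q h => by
          rw [isTangle_cap_cup]
          simp only [IsTangle, cross, Piece.inputs, Piece.outputs] at *; omega
      have m0 := ih _ (by
        rw [← hn, List.append_assoc]
        exact complexity_append_lt u (by simp only [cross, List.cons_append, complexity, List.nil_append]; omega)) h0 rfl
      have m1 := ih _ (by
        rw [← hn, List.append_assoc, List.append_assoc]
        exact complexity_append_lt u (by
          simp only [cross, cup, cap, List.cons_append, complexity, List.nil_append]; omega)) h1 rfl
      have := add_mem (add_mem (rel (.crossing h h0 h1)) (Submodule.smul_mem _ (smoothCoeff e) m0))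
        (Submodule.smul_mem _ (smoothCoeff !e) m1)
      convert this using 1
      abel
    · rcases cup_cap_cases i j with rfl | hm | ⟨i', j', hm, ht⟩
      · have h0 : IsTangle p (u ++ v) q := by
          have := h.replace (r := []) fun p q h => (isTangle_cup_cap.1 h).2.2
          simpa using this
        have m0 := ih _ (by
          rw [← hn, List.append_assoc]
          exact complexity_append_lt u (by
            simp only [cup, cap, List.cons_append, complexity, List.nil_append]; omega)) h0 rfl
        have := add_mem (rel (.circle h h0)) (Submodule.smul_mem _ loopValue m0)
        simpa using this
      · have h0 : IsTangle p (u ++ [] ++ v) q :=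
          h.replace fun p q h => (isTangle_cup_cap.1 h).2.2
        have m0 := ih _ (by
          rw [← hn, List.append_assoc, List.append_assoc]
          exact complexity_append_lt u (by
            simp only [cup, cap, List.cons_append, complexity, List.nil_append]; omega)) h0 rfl
        have := add_mem (rel (.move hm h h0)) m0
        simpa using this
      · have h0 := h.replace ht
        have m0 := ih _ (by
          rw [← hn, List.append_assoc, List.append_assoc]
          exact complexity_append_lt u (by
            simp only [cup, cap, List.cons_append, complexity, List.nil_append]; omega)) h0 rfl
        rcases hm with hm | hm
        · have := add_mem (rel (.move hm h h0)) m0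
          simpa using this
        -- The move is listed in the opposite direction here, so its relator enters with a minus
        -- sign.
        · have := sub_mem m0 (rel (.move hm h0 h))
          simpa using this

theorem tangles_le_reducible (p q : ℕ) : tangles p q ≤ reducible p q := by
  refine Submodule.span_le.2 ?_
  rintro _ ⟨w, hw, rfl⟩
  exact ofWord_mem_reducible hw

theorem isTangle_of_forall_cup {p q : ℕ} {b : List Slice} (hb : ∀ s ∈ b, ∃ i, s = cup i)
    (h : IsTangle p b q) : q = p + 2 * b.length := by
  induction b generalizing p with
  | nil => simpa [IsTangle] using h.symm
  | cons s b ih =>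
    obtain ⟨i, rfl⟩ := hb s (by simp)
    have := ih (fun s hs => hb s (by simp [hs])) h.2
    simp [cup, Piece.inputs, Piece.outputs] at this ⊢
    omega

theorem isTangle_of_forall_cap {p q : ℕ} {b : List Slice} (hb : ∀ s ∈ b, ∃ i, s = cap i)
    (h : IsTangle p b q) : p = q + 2 * b.length := by
  induction b generalizing p with
  | nil => simpa [IsTangle] using h
  | cons s b ih =>
    obtain ⟨i, rfl⟩ := hb s (by simp)
    have := ih (fun s hs => hb s (by simp [hs])) h.2
    have := h.1
    simp [cap, Piece.inputs, Piece.outputs] at *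
    omega

/-! ### The skein module is spanned by the parallels of the core -/

/-- The closure around the annulus as a linear map. -/
def closureLin (m : ℕ) : Formal →ₗ[K] Skein :=
  open Classical in
  (Finsupp.linearCombination K fun w : FreeMonoid Slice =>
    if h : IsTangle m w.toList m then (AnnularDiagram.mk m w.toList h).bracket else 0) ∘ₗ
    (MonoidAlgebra.coeffLinearEquiv K).toLinearMap

theorem closure_eq (m : ℕ) (y : Formal) : closure m y = closureLin m y := by
  simp only [closure, closureLin, LinearMap.comp_apply, Finsupp.linearCombination_apply]
  refine Finsupp.sum_congr fun w _ => ?_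
  split_ifs <;> simp

theorem closureLin_ofWord {m : ℕ} {w : List Slice} (h : IsTangle m w m) :
    closureLin m (ofWord w) = (AnnularDiagram.mk m w h).bracket := by
  simp [closureLin, ofWord, h]

theorem bracket_eq_of_move {D D' : AnnularDiagram} (h : AnnularMove FramedLocalMove D D') :
    D.bracket = D'.bracket := by
  have : D.framed = D'.framed := Quot.sound h
  simp [AnnularDiagram.bracket, gen, this]

theorem closureLin_localRelator {m : ℕ} {y : Formal} (h : LocalRelator m m y) :
    closureLin m y = 0 := by
  cases h with
  | move hlr hl hr =>
    rw [map_sub, closureLin_ofWord hl, closureLin_ofWord hr,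
      bracket_eq_of_move (.in_place hlr hl hr), sub_self]
  | @crossing e i u v hx h0 h1 =>
    rw [map_sub, map_sub, map_smul, map_smul, closureLin_ofWord hx, closureLin_ofWord h0,
      closureLin_ofWord h1]
    simp only [AnnularDiagram.bracket, ← Submodule.Quotient.mk_smul, ← Submodule.Quotient.mk_sub]
    rw [Submodule.Quotient.mk_eq_zero]
    refine Submodule.subset_span ?_
    cases e
    · have := SkeinRelator.crossing_false hx h0 h1
      rw [sub_right_comm]
      exact this
    · exact SkeinRelator.crossing_true hx h0 h1
  | circle hc h0 =>
    rw [map_sub, map_smul, closureLin_ofWord hc, closureLin_ofWord h0]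
    simp only [AnnularDiagram.bracket, ← Submodule.Quotient.mk_smul, ← Submodule.Quotient.mk_sub]
    rw [Submodule.Quotient.mk_eq_zero]
    refine Submodule.subset_span ?_
    have := SkeinRelator.circle hc h0
    rwa [show A ^ 2 + A⁻¹ ^ 2 = -loopValue by rw [loopValue]; ring, neg_smul,
      ← sub_eq_add_neg] at this

/-- Induction on the width. A normal form with equal ends and no maxima has no minima either and is
a parallel of the core. Otherwise the level between its maxima and its minima has fewer than `m`
points, and cutting the annulus there gives a diagram of smaller width. -/
theorem bracket_mem_span (D : AnnularDiagram) :
    D.bracket ∈ Submodule.span K (Set.range fun j => (coreParallel j).bracket) := by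
  obtain ⟨m, w, h⟩ := D
  induction m using Nat.strong_induction_on generalizing w with
  | _ m ih =>
    rw [← closureLin_ofWord h]
    have hw := ofWord_mem_reducible h
    generalize ofWord w = y at hw
    suffices H : reducible m m ≤ (Submodule.span K
        (Set.range fun j => (coreParallel j).bracket)).comap (closureLin m) from H hw
    refine sup_le (Submodule.span_le.2 ?_) (Submodule.span_le.2 ?_)
    · intro y hy
      simp [closureLin_localRelator hy]
    · rintro _ ⟨w, hw, ⟨a, b, rfl, ha, hb⟩, rfl⟩
      simp only [Submodule.comap_coe, Set.mem_preimage, SetLike.mem_coe]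
      rw [closureLin_ofWord hw]
      obtain ⟨p, hpa, hpb⟩ := isTangle_append.1 hw
      have ea := isTangle_of_forall_cap ha hpa
      rcases a with _ | ⟨s, a⟩
      · have eb := isTangle_of_forall_cup hb hpb
        obtain rfl : b = [] := by
          rw [← List.length_eq_zero_iff]
          simp at ea
          omega
        exact Submodule.subset_span ⟨m, rfl⟩
      · rw [bracket_eq_of_move (.rotate hpa hpb hw (hpb.append hpa))]
        exact ih p (by simp at ea; omega) _ _

theorem span_coreParallel :
    Submodule.span K (Set.range fun j => (coreParallel j).bracket) = ⊤ := by
  refine eq_top_iff.2 fun s _ => ?_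
  obtain ⟨y, rfl⟩ := Submodule.Quotient.mk_surjective _ s
  induction y using Finsupp.induction_linear with
  | zero => exact zero_mem _
  | add a b ha hb => exact add_mem (ha trivial) (hb trivial)
  | single L a =>
    obtain ⟨D, rfl⟩ := Quot.exists_rep L
    have : (Finsupp.single (Quot.mk _ D) a : FreeSkein) = a • gen D := by simp [gen]; rfl
    rw [this, Submodule.Quotient.mk_smul]
    exact Submodule.smul_mem _ _ (bracket_mem_span D)

/-! ### Representations respect the skein relations. -/

namespace TLRep

variable {R : Type} [Ring R] [Algebra K R] (T : TLRep R)

theorem word_eq_of_framedLocalMove {l r : List Slice} (h : FramedLocalMove l r) :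
    T.word l = T.word r := by
  cases h <;> simp only [word_cons, word_nil, mul_one, slice_cup, slice_cap, slice_cross]
  case independent => exact T.slice_far _ _ _ _
  case zigzag_left => exact T.zigzag_left _
  case zigzag_right => exact T.zigzag_right _
  case turn_cup => exact T.turn_cup _ _
  case turn_cap => exact T.turn_cap _ _
  case type_II => exact T.type_II _ _
  case type_III => simpa only [mul_assoc] using T.type_III _ _
  case type_I_framed => simpa only [mul_assoc] using T.type_I_framed _ _

theorem eval_localRelator {p q : ℕ} {y : Formal} (h : LocalRelator p q y) : T.eval y = 0 := by
  cases h with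
  | move hlr hl hr => simp [word_eq_of_framedLocalMove T hlr]
  | crossing hx h0 h1 =>
    simp only [map_sub, map_smul, eval_ofWord, word_append, word_cons, word_nil, mul_one,
      slice_cross, slice_cap, slice_cup, x, u, mul_add, add_mul, mul_smul_comm, smul_mul_assoc,
      mul_assoc]
    abel
  | circle hc h0 =>
    simp only [map_sub, map_smul, eval_ofWord, word_append, word_cons, word_nil, mul_one,
      slice_cap, slice_cup, T.loop, mul_smul_comm, smul_mul_assoc, sub_self]

end TLRep

/-! ### A representation on infinite sequences of spins -/

/-- Insert the spins `a, b` at the positions `i, i + 1`. -/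
def ins (i : ℕ) (a b : Bool) (f : ℕ → Bool) : ℕ → Bool := fun j =>
  if j < i then f j else if j = i then a else if j = i + 1 then b else f (j - 2)

/-- Delete the spins at the positions `i, i + 1`. -/
def del (i : ℕ) (f : ℕ → Bool) : ℕ → Bool := fun j => if j < i then f j else f (j + 2)

theorem ins_ins (i k : ℕ) (a b a' b' : Bool) (f : ℕ → Bool) :
    ins (i + 2 + k) a b (ins i a' b' f) = ins i a' b' (ins (i + k) a b f) := by
  funext j; simp only [ins]; grind (splits := 20)

theorem del_ins_right (i k : ℕ) (a b : Bool) (f : ℕ → Bool) :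
    del (i + 2 + k) (ins i a b f) = ins i a b (del (i + k) f) := by
  funext j; simp only [ins, del]; grind

theorem del_ins_left (i k : ℕ) (a b : Bool) (f : ℕ → Bool) :
    del i (ins (i + 2 + k) a b f) = ins (i + k) a b (del i f) := by
  funext j; simp only [ins, del]; grind

theorem del_del (i k : ℕ) (f : ℕ → Bool) : del (i + k) (del i f) = del i (del (i + 2 + k) f) := by
  funext j; simp only [del]; grind

theorem ins_apply_far (i k : ℕ) (a b : Bool) (f : ℕ → Bool) :
    ins i a b f (i + 2 + k) = f (i + k) := by
  simp only [ins]; grind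

theorem ins_apply_lt {i j : ℕ} (h : j < i) (a b : Bool) (f : ℕ → Bool) : ins i a b f j = f j := by
  simp only [ins]; grind

theorem ins_apply_left (i : ℕ) (a b : Bool) (f : ℕ → Bool) : ins i a b f i = a := by
  simp [ins]

theorem ins_apply_right (i : ℕ) (a b : Bool) (f : ℕ → Bool) : ins i a b f (i + 1) = b := by
  simp [ins]

theorem del_ins_self (i : ℕ) (a b : Bool) (f : ℕ → Bool) : del i (ins i a b f) = f := by
  funext j; simp only [ins, del]; grind

theorem del_ins_succ (i : ℕ) (a b : Bool) (f : ℕ → Bool) (h : b = f i) :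
    del i (ins (i + 1) a b f) = f := by
  funext j; simp only [ins, del]; grind

theorem del_succ_ins (i : ℕ) (a b : Bool) (f : ℕ → Bool) (h : a = f i) :
    del (i + 1) (ins i a b f) = f := by
  funext j; simp only [ins, del]; grind

/-- The weight of a minimum whose left leg carries the spin `b`. -/
def cupWeight (b : Bool) : K := if b then 1 else -A ^ 2

/-- The weight of a maximum whose legs carry the spins `a, b`. -/
def capWeight (a b : Bool) : K := if a = b then 0 else if a then -A⁻¹ ^ 2 else 1

theorem cupWeight_mul_capWeight (b : Bool) : cupWeight b * capWeight (!b) b = 1 := by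
  cases b <;> simp [cupWeight, capWeight, A_ne_zero]

/-- The vector space spanned by the sequences of spins. -/
abbrev Spins : Type := (ℕ → Bool) →₀ K

/-- A minimum as an operator on sequences of spins. -/
def cupOp (i : ℕ) : Module.End K Spins := Finsupp.linearCombination K fun f =>
  cupWeight true • Finsupp.single (ins i true false f) 1 +
    cupWeight false • Finsupp.single (ins i false true f) 1

/-- A maximum as an operator on sequences of spins. -/
def capOp (i : ℕ) : Module.End K Spins := Finsupp.linearCombination K fun f =>
  capWeight (f i) (f (i + 1)) • Finsupp.single (del i f) 1

theorem cupOp_single (i : ℕ) (f : ℕ → Bool) : cupOp i (Finsupp.single f 1) =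
    cupWeight true • Finsupp.single (ins i true false f) 1 +
      cupWeight false • Finsupp.single (ins i false true f) 1 := by
  simp only [cupOp, Finsupp.linearCombination_single, one_smul]

theorem capOp_single (i : ℕ) (f : ℕ → Bool) : capOp i (Finsupp.single f 1) =
    capWeight (f i) (f (i + 1)) • Finsupp.single (del i f) 1 := by
  simp only [capOp, Finsupp.linearCombination_single, one_smul]

/-- Words are read upwards, so the left factor of a product acts first; the opposite of the
endomorphism ring accounts for this. -/
theorem op_mul_op_eq {a b c d : Module.End K Spins}
    (h : ∀ f, b (a (Finsupp.single f 1)) = d (c (Finsupp.single f 1))) :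
    MulOpposite.op a * MulOpposite.op b = MulOpposite.op c * MulOpposite.op d := by
  rw [← MulOpposite.op_mul, ← MulOpposite.op_mul]
  congr 1
  refine Finsupp.lhom_ext' fun f => LinearMap.ext_ring ?_
  exact h f

theorem op_mul_op_eq_smul {a b : Module.End K Spins} {r : K}
    (h : ∀ f, b (a (Finsupp.single f 1)) = r • Finsupp.single f 1) :
    MulOpposite.op a * MulOpposite.op b = r • 1 := by
  rw [← MulOpposite.op_mul, ← MulOpposite.op_one, ← MulOpposite.op_smul]
  congr 1
  refine Finsupp.lhom_ext' fun f => LinearMap.ext_ring ?_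
  exact h f

/-- The representation on sequences of spins. -/
def spinRep : TLRep (Module.End K Spins)ᵐᵒᵖ where
  c i := MulOpposite.op (cupOp i)
  d i := MulOpposite.op (capOp i)
  cc i k := op_mul_op_eq fun f => by
    simp only [cupOp_single, map_add, map_smul, ins_ins, smul_add]
    simp only [smul_comm (cupWeight false) (cupWeight true)]
    abel
  cd i k := op_mul_op_eq fun f => by
    have h : ∀ a b, ins i a b f (i + 2 + k + 1) = f (i + k + 1) := fun a b =>
      ins_apply_far i (k + 1) a b f
    simp only [cupOp_single, capOp_single, map_add, map_smul, del_ins_right, ins_apply_far, h,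
      smul_add]
    rw [smul_comm (cupWeight true), smul_comm (cupWeight false)]
  dc i k := op_mul_op_eq fun f => by
    simp only [cupOp_single, capOp_single, map_add, map_smul, del_ins_left, smul_add]
    simp only [ins_apply_lt (show i < i + 2 + k by omega),
      ins_apply_lt (show i + 1 < i + 2 + k by omega)]
    rw [smul_comm (cupWeight true), smul_comm (cupWeight false)]
  dd i k := op_mul_op_eq fun f => by
    simp only [capOp_single, map_smul, del_del]
    rw [smul_comm]
    have h1 : del i f (i + k) = f (i + 2 + k) := by simp only [del]; grind
    have h2 : del i f (i + k + 1) = f (i + 2 + k + 1) := by simp only [del]; grind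
    have h3 : del (i + 2 + k) f i = f i := by simp only [del]; grind
    have h4 : del (i + 2 + k) f (i + 1) = f (i + 1) := by simp only [del]; grind
    rw [h1, h2, h3, h4]
  zigzag_left i := by
    rw [← one_smul K (1 : (Module.End K Spins)ᵐᵒᵖ)]
    refine op_mul_op_eq_smul fun f => ?_
    simp only [cupOp_single, capOp_single, map_add, map_smul, ins_apply_lt (Nat.lt_succ_self i),
      ins_apply_left]
    rcases hf : f i with _ | _
    · rw [del_ins_succ i true false f hf.symm, smul_smul, ← cupWeight_mul_capWeight true]
      simp [capWeight]
    · rw [del_ins_succ i false true f hf.symm, smul_smul (cupWeight false),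
        ← cupWeight_mul_capWeight false]
      simp [capWeight]
  zigzag_right i := by
    rw [← one_smul K (1 : (Module.End K Spins)ᵐᵒᵖ)]
    refine op_mul_op_eq_smul fun f => ?_
    have h : ∀ a b, ins i a b f (i + 1 + 1) = f i := fun a b => ins_apply_far i 0 a b f
    simp only [cupOp_single, capOp_single, map_add, map_smul, ins_apply_right, h]
    rcases hf : f i with _ | _
    · rw [del_succ_ins i false true f hf.symm, smul_smul (cupWeight false)]
      simp [capWeight, cupWeight, A_ne_zero]
    · rw [del_succ_ins i true false f hf.symm, smul_smul (cupWeight true)]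
      simp [capWeight, cupWeight]
  loop i := op_mul_op_eq_smul fun f => by
    simp only [cupOp_single, capOp_single, map_add, map_smul, ins_apply_right, ins_apply_left,
      del_ins_self, smul_smul, ← add_smul]
    congr 1
    simp [cupWeight, capWeight, loopValue]
    ring

/-- The constant sequence of spins is killed by all maxima. -/
theorem capOp_const (i : ℕ) : capOp i (Finsupp.single (fun _ => true) 1) = 0 := by
  simp [capOp_single, capWeight]

/-! ### The weighted trace -/

open Classical in
/-- The sequences of spins that are `true` from position `m` on. -/
def states (m : ℕ) : Finset (ℕ → Bool) :=
  Finset.univ.image fun (s : Fin m → Bool) j => if h : j < m then s ⟨j, h⟩ else true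

theorem mem_states {m : ℕ} {f : ℕ → Bool} : f ∈ states m ↔ ∀ j, m ≤ j → f j = true := by
  simp only [states, Finset.mem_image, Finset.mem_univ, true_and]
  constructor
  · rintro ⟨s, rfl⟩ j hj
    simp [Nat.not_lt.2 hj]
  · intro h
    refine ⟨fun j => f j, funext fun j => ?_⟩
    by_cases hj : j < m
    · simp [hj]
    · simp [hj, h j (Nat.not_lt.1 hj)]

/-- The weight of a sequence of spins in the trace on `m` strands. -/
def spinWeight (t : K) (m : ℕ) (f : ℕ → Bool) : K :=
  ∏ j ∈ Finset.range m, if f j then t else t⁻¹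

/-- The inserted spins are opposite, so their weights `t` and `t⁻¹` cancel. This conservation law is
what makes the weighted trace cyclic. -/
theorem spinWeight_ins {t : K} (ht : t ≠ 0) {m i : ℕ} (hi : i ≤ m) (b : Bool) (f : ℕ → Bool) :
    spinWeight t (m + 2) (ins i b (!b) f) = spinWeight t m f := by
  obtain ⟨k, rfl⟩ := Nat.exists_eq_add_of_le hi
  rw [spinWeight, spinWeight, show i + k + 2 = i + (2 + k) by omega, Finset.prod_range_add,
    Finset.prod_range_add, Finset.prod_range_add]
  have h1 : ∀ j ∈ Finset.range i, (if ins i b (!b) f j then t else t⁻¹) =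
      if f j then t else t⁻¹ := fun j hj => by rw [ins_apply_lt (Finset.mem_range.1 hj)]
  rw [Finset.prod_congr rfl h1]
  simp only [← add_assoc, ins_apply_far, Finset.prod_range_succ, Finset.prod_range_zero, one_mul,
    add_zero, ins_apply_left, ins_apply_right]
  cases b <;> simp [ht]

theorem ins_del_self (i : ℕ) (f : ℕ → Bool) : ins i (f i) (f (i + 1)) (del i f) = f := by
  funext j; simp only [ins, del]; grind

theorem ins_mem_states {m i : ℕ} (hi : i ≤ m) (a b : Bool) {f : ℕ → Bool} (hf : f ∈ states m) :
    ins i a b f ∈ states (m + 2) := by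
  rw [mem_states] at *
  intro j hj
  rw [ins, if_neg (by omega), if_neg (by omega), if_neg (by omega)]
  exact hf _ (by omega)

theorem del_mem_states {m i : ℕ} (hi : i ≤ m) {f : ℕ → Bool} (hf : f ∈ states (m + 2)) :
    del i f ∈ states m := by
  rw [mem_states] at *
  intro j hj
  rw [del, if_neg (by omega)]
  exact hf _ (by omega)

/-- The operators that map states of `p` strands to combinations of states of `q` strands of the
same weight. -/
def homogeneous (t : K) (p q : ℕ) : Submodule K (Module.End K Spins)ᵐᵒᵖ where
  carrier := {y | ∀ f ∈ states p, ∀ g, ¬ (g ∈ states q ∧ spinWeight t q g = spinWeight t p f) →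
    y.unop (Finsupp.single f 1) g = 0}
  zero_mem' f _ g _ := by simp
  add_mem' ha hb f hf g hg := by simp [ha f hf g hg, hb f hf g hg]
  smul_mem' r a ha f hf g hg := by simp [ha f hf g hg]

/-- Finite matrix calculus on an infinite-dimensional space: only the basis vectors in `S`
contribute. -/
theorem apply_eq_sum (L : Module.End K Spins) {v : Spins} {S : Finset (ℕ → Bool)}
    (hv : ∀ g, g ∉ S → v g = 0) (f : ℕ → Bool) :
    L v f = ∑ g ∈ S, v g * L (Finsupp.single g 1) f := by
  have : v = ∑ g ∈ S, v g • Finsupp.single g 1 := by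
    have hs : v.support ⊆ S := fun g hg => by
      by_contra h
      exact (Finsupp.mem_support_iff.1 hg) (hv g h)
    conv_lhs => rw [← Finsupp.sum_single v]
    rw [Finsupp.sum_of_support_subset v hs _ (by simp)]
    simp
  conv_lhs => rw [this]
  simp only [map_sum, map_smul, Finsupp.finsetSum_apply, Finsupp.smul_apply, smul_eq_mul]

theorem mul_mem_homogeneous {t : K} {p q r : ℕ} {y z : (Module.End K Spins)ᵐᵒᵖ}
    (hy : y ∈ homogeneous t p q) (hz : z ∈ homogeneous t q r) : y * z ∈ homogeneous t p r := by
  intro f hf g hg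
  change z.unop (y.unop (Finsupp.single f 1)) g = 0
  rw [apply_eq_sum z.unop (S := states q) fun g hg => hy f hf g fun h => hg h.1]
  refine Finset.sum_eq_zero fun a ha => ?_
  by_cases hw : spinWeight t q a = spinWeight t p f
  · rw [hz a ha g fun h => hg ⟨h.1, h.2.trans hw⟩, mul_zero]
  · rw [hy f hf a fun h => hw h.2, zero_mul]

theorem one_mem_homogeneous (t : K) (p : ℕ) : 1 ∈ homogeneous t p p := by
  intro f hf g hg
  change (Finsupp.single f (1 : K)) g = 0
  classical rw [Finsupp.single_apply, if_neg]
  rintro rfl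
  exact hg ⟨hf, rfl⟩

theorem c_mem_homogeneous {t : K} (ht : t ≠ 0) {p i : ℕ} (hi : i ≤ p) :
    spinRep.c i ∈ homogeneous t p (p + 2) := by
  intro f hf g hg
  change cupOp i (Finsupp.single f 1) g = 0
  have h : ∀ b, ins i b (!b) f ≠ g := by
    rintro b rfl
    exact hg ⟨ins_mem_states hi _ _ hf, spinWeight_ins ht hi b f⟩
  rw [cupOp_single]
  simp [Finsupp.single_eq_of_ne' (show ins i true false f ≠ g from h true),
    Finsupp.single_eq_of_ne' (show ins i false true f ≠ g from h false)]

theorem d_mem_homogeneous {t : K} (ht : t ≠ 0) {p i : ℕ} (hi : i ≤ p) :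
    spinRep.d i ∈ homogeneous t (p + 2) p := by
  intro f hf g hg
  change capOp i (Finsupp.single f 1) g = 0
  rw [capOp_single]
  by_cases hw : f i = f (i + 1)
  · simp [capWeight, hw]
  · have : del i f ≠ g := by
      rintro rfl
      refine hg ⟨del_mem_states hi hf, ?_⟩
      rw [← spinWeight_ins ht hi (f i) (del i f), show (!f i) = f (i + 1) by cases h : f i <;> cases h' : f (i + 1) <;> simp_all, ins_del_self]
    simp [Finsupp.single_eq_of_ne' this]

theorem slice_mem_homogeneous {t : K} (ht : t ≠ 0) {p : ℕ} {s : Slice}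
    (h : s.pos + s.piece.inputs ≤ p) :
    spinRep.slice s ∈ homogeneous t p (p - s.piece.inputs + s.piece.outputs) := by
  rcases s with ⟨_ | _ | e, i⟩ <;> simp only [Piece.inputs, Piece.outputs] at h ⊢
  · exact c_mem_homogeneous ht h
  · obtain ⟨p, rfl⟩ := Nat.exists_eq_add_of_le' (show 2 ≤ p by omega)
    exact d_mem_homogeneous ht (by omega)
  · obtain ⟨p, rfl⟩ := Nat.exists_eq_add_of_le' (show 2 ≤ p by omega)
    refine add_mem (Submodule.smul_mem _ _ (one_mem_homogeneous t _)) (Submodule.smul_mem _ _ ?_)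
    exact mul_mem_homogeneous (d_mem_homogeneous ht (by omega)) (c_mem_homogeneous ht (by omega))

theorem word_mem_homogeneous {t : K} (ht : t ≠ 0) {p q : ℕ} {w : List Slice}
    (h : IsTangle p w q) : spinRep.word w ∈ homogeneous t p q := by
  induction w generalizing p with
  | nil => obtain rfl : p = q := h; exact one_mem_homogeneous t p
  | cons s w ih =>
    rw [TLRep.word_cons]
    exact mul_mem_homogeneous (slice_mem_homogeneous ht h.1) (ih h.2)

theorem eval_mem_homogeneous {t : K} (ht : t ≠ 0) {p q : ℕ} {y : Formal}
    (h : y ∈ tangles p q) : spinRep.eval y ∈ homogeneous t p q := by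
  suffices H : tangles p q ≤ (homogeneous t p q).comap spinRep.eval.toLinearMap from H h
  refine Submodule.span_le.2 ?_
  rintro _ ⟨w, hw, rfl⟩
  simpa using word_mem_homogeneous ht hw

/-- The weighted trace on `m` strands. -/
def spinTrace (t : K) (m : ℕ) : (Module.End K Spins)ᵐᵒᵖ →ₗ[K] K where
  toFun y := ∑ f ∈ states m, spinWeight t m f * y.unop (Finsupp.single f 1) f
  map_add' a b := by simp [mul_add, Finset.sum_add_distrib]
  map_smul' r a := by simp [Finset.mul_sum, mul_left_comm]

/-- Both sides are double sums over matrix entries of `y` and `z`. The weight is taken at `f` on one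
side and at `g` on the other, and these agree wherever the entries are nonzero. -/
theorem spinTrace_mul_comm {t : K} {p q : ℕ} {y z : (Module.End K Spins)ᵐᵒᵖ}
    (hy : y ∈ homogeneous t p q) (hz : z ∈ homogeneous t q p) :
    spinTrace t p (y * z) = spinTrace t q (z * y) := by
  have h : ∀ {p q : ℕ} {y z : (Module.End K Spins)ᵐᵒᵖ} (hy : y ∈ homogeneous t p q),
      spinTrace t p (y * z) = ∑ f ∈ states p, ∑ g ∈ states q, spinWeight t p f *
        (y.unop (Finsupp.single f 1) g * z.unop (Finsupp.single g 1) f) := by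
    intro p q y z hy
    refine Finset.sum_congr rfl fun f hf => ?_
    change _ * z.unop (y.unop (Finsupp.single f 1)) f = _
    rw [apply_eq_sum z.unop (S := states q) fun g hg => hy f hf g fun h => hg h.1,
      Finset.mul_sum]
  rw [h hy, h hz, Finset.sum_comm]
  refine Finset.sum_congr rfl fun g hg => Finset.sum_congr rfl fun f hf => ?_
  by_cases hw : spinWeight t q g = spinWeight t p f
  · rw [hw, mul_comm (y.unop _ g)]
  · rw [hy f hf g fun h => hw h.2, zero_mul, mul_zero, hz g hg f fun h => hw h.2.symm, zero_mul,
      mul_zero]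

-- The sum over all spin configurations factors strand by strand, each strand contributing `t +
-- t⁻¹`.
open Classical in
theorem spinTrace_one (t : K) (m : ℕ) : spinTrace t m 1 = (t + t⁻¹) ^ m := by
  change ∑ f ∈ states m, spinWeight t m f * (Finsupp.single f (1 : K)) f = _
  simp only [Finsupp.single_eq_same, mul_one]
  rw [states, Finset.sum_image]
  · have h : ∀ s : Fin m → Bool,
        spinWeight t m (fun j => if h : j < m then s ⟨j, h⟩ else true) =
          ∏ j : Fin m, if s j then t else t⁻¹ := fun s => by
      rw [spinWeight, ← Fin.prod_univ_eq_prod_range]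
      exact Finset.prod_congr rfl fun j _ => by simp
    simp only [h]
    have := Finset.prod_univ_sum (fun _ : Fin m => (Finset.univ : Finset Bool))
      (fun _ b => if b then t else t⁻¹)
    rw [Fintype.piFinset_univ] at this
    simpa using this.symm
  · intro s _ s' _ h
    funext j
    simpa using congrFun h j

/-! ### The functionals on the skein module -/

/-- Local moves hold already in the representation; moving the cut is cyclicity of the trace. -/
theorem spinTrace_eq_of_move {t : K} (ht : t ≠ 0) {D D' : AnnularDiagram}
    (h : AnnularMove FramedLocalMove D D') :
    spinTrace t D.width (spinRep.word D.word) = spinTrace t D'.width (spinRep.word D'.word) := by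
  cases h with
  | in_place hlr hl hr =>
    simp only [TLRep.word_append, TLRep.word_eq_of_framedLocalMove _ hlr]
  | rotate hu hv h h' =>
    simp only [TLRep.word_append]
    exact spinTrace_mul_comm (word_mem_homogeneous ht hu) (word_mem_homogeneous ht hv)

/-- The weighted trace on the free vector space. -/
def freeTrace {t : K} (ht : t ≠ 0) : FreeSkein →ₗ[K] K :=
  Finsupp.linearCombination K (Quot.lift
    (fun D : AnnularDiagram => spinTrace t D.width (spinRep.word D.word))
    fun _ _ h => spinTrace_eq_of_move ht h)

theorem freeTrace_gen {t : K} (ht : t ≠ 0) (D : AnnularDiagram) :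
    freeTrace ht (gen D) = spinTrace t D.width (spinRep.word D.word) := by
  rw [freeTrace, gen]
  exact (Finsupp.linearCombination_single K 1 D.framed).trans (one_smul K _)

theorem freeTrace_skeinRelator {t : K} (ht : t ≠ 0) {y : FreeSkein} (h : SkeinRelator y) :
    freeTrace ht y = 0 := by
  cases h with
  | @crossing_true m i u v hx h0 h1 =>
    rw [show A = smoothCoeff true from rfl, show (smoothCoeff true)⁻¹ = smoothCoeff (!true) from rfl]
    have := spinRep.eval_localRelator (.crossing (e := true) hx h0 h1)
    simp only [map_sub, map_smul, TLRep.eval_ofWord] at this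
    simp only [map_sub, map_smul, freeTrace_gen]
    have h2 := congrArg (spinTrace t m) this
    simpa only [map_sub, map_smul, map_zero] using h2
  | @crossing_false m i u v hx h0 h1 =>
    rw [show A⁻¹ = smoothCoeff false from rfl, show A = smoothCoeff (!false) from rfl]
    have := spinRep.eval_localRelator (.crossing (e := false) hx h0 h1)
    simp only [map_sub, map_smul, TLRep.eval_ofWord] at this
    simp only [map_sub, map_smul, freeTrace_gen]
    have h2 := congrArg (spinTrace t m) this
    rw [sub_right_comm]
    simpa only [map_sub, map_smul, map_zero] using h2
  | @circle m i u v hc h0 =>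
    have := spinRep.eval_localRelator (.circle hc h0)
    simp only [map_sub, map_smul, TLRep.eval_ofWord] at this
    have h2 := congrArg (spinTrace t m) this
    rw [show A ^ 2 + A⁻¹ ^ 2 = -loopValue by rw [loopValue]; ring, neg_smul, ← sub_eq_add_neg]
    simp only [map_sub, map_smul, freeTrace_gen]
    simpa only [map_sub, map_smul, map_zero] using h2

/-- The weighted trace on the skein module. -/
def skeinTrace {t : K} (ht : t ≠ 0) : Skein →ₗ[K] K :=
  Submodule.liftQ _ (freeTrace ht) (Submodule.span_le.2 fun _ h => freeTrace_skeinRelator ht h)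

theorem skeinTrace_bracket {t : K} (ht : t ≠ 0) (D : AnnularDiagram) :
    skeinTrace ht D.bracket = spinTrace t D.width (spinRep.word D.word) := by
  simp [skeinTrace, AnnularDiagram.bracket, freeTrace_gen]

theorem skeinTrace_closureLin {t : K} (ht : t ≠ 0) {m : ℕ} {y : Formal} (hy : y ∈ tangles m m) :
    skeinTrace ht (closureLin m y) = spinTrace t m (spinRep.eval y) := by
  induction hy using Submodule.span_induction with
  | mem y h =>
    obtain ⟨w, hw, rfl⟩ := h
    rw [closureLin_ofWord hw, skeinTrace_bracket, TLRep.eval_ofWord]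
  | zero => simp
  | add a b _ _ ha hb => simp only [map_add, ha, hb]
  | smul r a _ ha => simp only [map_smul, ha]

theorem skeinTrace_coreParallel {t : K} (ht : t ≠ 0) (j : ℕ) :
    skeinTrace ht (coreParallel j).bracket = (t + t⁻¹) ^ j := by
  rw [skeinTrace_bracket]
  exact spinTrace_one t j

/-! ### The skein module as the space of polynomials in the core. -/

/-- A polynomial evaluated at the core of the annulus. -/
def evalCore : Polynomial K →ₗ[K] Skein :=
  Polynomial.lsum fun j => LinearMap.toSpanSingleton K Skein (coreParallel j).bracket

theorem evalCore_eq_sum (P : Polynomial K) :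
    evalCore P = P.sum fun j c => c • (coreParallel j).bracket := by
  simp [evalCore, Polynomial.lsum_apply]

theorem evalCore_surjective : Function.Surjective evalCore := by
  rw [← LinearMap.range_eq_top, eq_top_iff, ← span_coreParallel, Submodule.span_le]
  rintro _ ⟨j, rfl⟩
  refine ⟨Polynomial.monomial j 1, ?_⟩
  simp [evalCore_eq_sum, Polynomial.sum_monomial_index]

theorem skeinTrace_evalCore {t : K} (ht : t ≠ 0) (P : Polynomial K) :
    skeinTrace ht (evalCore P) = P.eval (t + t⁻¹) := by
  rw [evalCore_eq_sum, Polynomial.sum, map_sum, Polynomial.eval_eq_sum, Polynomial.sum]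
  simp [skeinTrace_coreParallel]

/-- The values `t + t⁻¹` are infinitely many: equality at `t` and `s` forces `t = s` or `t * s = 1`.
-/
theorem eq_zero_of_eval_add_inv {P : Polynomial K}
    (h : ∀ t : K, t ≠ 0 → P.eval (t + t⁻¹) = 0) : P = 0 := by
  refine Polynomial.eq_zero_of_infinite_isRoot P ?_
  -- Starting at `2` keeps `t` nonzero and excludes the case of a product equal to `1`.
  have hinj : Function.Injective fun n : ℕ => ((n : K) + 2) + ((n : K) + 2)⁻¹ := by
    intro a b hab
    have ha : (a : K) + 2 ≠ 0 := by exact_mod_cast (show a + 2 ≠ 0 by omega)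
    have hb : (b : K) + 2 ≠ 0 := by exact_mod_cast (show b + 2 ≠ 0 by omega)
    have h2 : ((a : K) - b) * (((a : K) + 2) * (b + 2) - 1) = 0 := by
      have h1 : ((a : K) + 2) + ((a : K) + 2)⁻¹ = ((b : K) + 2) + ((b : K) + 2)⁻¹ := hab
      have h3 := congrArg (fun s => s * (((a : K) + 2) * (b + 2))) h1
      field_simp at h3
      linear_combination h3
    rcases mul_eq_zero.1 h2 with h3 | h3
    · exact_mod_cast sub_eq_zero.1 h3
    · exfalso
      have : ((a + 2) * (b + 2) : K) = 1 := sub_eq_zero.1 h3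
      have h4 : (a + 2) * (b + 2) = 1 := by exact_mod_cast this
      have := Nat.eq_one_of_mul_eq_one_right h4
      omega
  refine (Set.infinite_range_of_injective hinj).mono ?_
  rintro _ ⟨n, rfl⟩
  exact h _ (by exact_mod_cast (show n + 2 ≠ 0 by omega))

theorem evalCore_injective : Function.Injective evalCore := by
  rw [injective_iff_map_eq_zero]
  intro P hP
  exact eq_zero_of_eval_add_inv fun t ht => by rw [← skeinTrace_evalCore ht, hP, map_zero]

/-- This reduces every identity in the skein module to a computation of traces in `spinRep`. -/
theorem skein_ext {s s' : Skein} (h : ∀ (t : K) (ht : t ≠ 0), skeinTrace ht s = skeinTrace ht s') :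
    s = s' := by
  obtain ⟨P, rfl⟩ := evalCore_surjective s
  obtain ⟨Q, rfl⟩ := evalCore_surjective s'
  rw [← sub_eq_zero, ← map_sub, eq_zero_of_eval_add_inv (P := P - Q), map_zero]
  intro t ht
  rw [← skeinTrace_evalCore ht, map_sub, map_sub, h, sub_self]

/-! ### Interchange of distant tangles -/

namespace TLRep

variable {R : Type} [Ring R] [Algebra K R] (T : TLRep R)

theorem slice_mul_slice_shift {p : ℕ} {s : Slice} (h : s.pos + s.piece.inputs ≤ p) (t : Slice) :
    T.slice s * T.slice (t.shift (p - s.piece.inputs + s.piece.outputs)) =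
      T.slice (t.shift p) * T.slice s := by
  obtain ⟨k, rfl⟩ := Nat.exists_eq_add_of_le h
  have := T.slice_far s.piece t.piece s.pos (k + t.pos)
  rw [← add_assoc, ← add_assoc] at this
  have e : t.shift (s.pos + s.piece.inputs + k - s.piece.inputs + s.piece.outputs) =
      ⟨t.piece, s.pos + s.piece.outputs + k + t.pos⟩ := by
    simp only [Slice.shift, Slice.mk.injEq, true_and]
    omega
  rw [e]
  exact this

theorem word_mul_word_shift {p q : ℕ} {v : List Slice} (h : IsTangle p v q) (w : List Slice) :
    T.word v * T.word (w.map (Slice.shift q)) = T.word (w.map (Slice.shift p)) * T.word v := by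
  induction v generalizing p with
  | nil => obtain rfl : p = q := h; simp
  | cons s v ih =>
    rw [word_cons, mul_assoc, ih h.2, ← mul_assoc, ← mul_assoc]
    congr 1
    have h1 := h.1
    clear ih h
    induction w with
    | nil => simp
    | cons t w ihw =>
      simp only [List.map_cons, word_cons]
      rw [← mul_assoc, slice_mul_slice_shift T h1, mul_assoc, ihw, mul_assoc]

/-- The tangle `z` stands to the right of `y`: it begins after `q` strands when placed above `y`,
and after `p` strands when placed below. -/
theorem eval_mul_eval_shift {p q : ℕ} {y : Formal} (hy : y ∈ tangles p q) (z : Formal) :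
    T.eval y * T.eval (AnnularSkein.shift q z) = T.eval (AnnularSkein.shift p z) * T.eval y := by
  induction hy using Submodule.span_induction with
  | mem y h =>
    obtain ⟨v, hv, rfl⟩ := h
    induction z using Formal.induction with
    | zero => simp
    | add a b ha hb => simp only [map_add, mul_add, add_mul, ha, hb]
    | word a w =>
      simp only [shift_smul, map_smul, shift_ofWord, eval_ofWord, mul_smul_comm, smul_mul_assoc,
        word_mul_word_shift T hv]
  | zero => simp
  | add a b _ _ ha hb => simp only [map_add, mul_add, add_mul, ha, hb]
  | smul r a _ ha => simp only [map_smul, mul_smul_comm, smul_mul_assoc, ha]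

end TLRep

/-! ### The Jones-Wenzl projectors -/

theorem A_pow_ne_one {k : ℕ} (hk : k ≠ 0) : A ^ k ≠ 1 := by
  intro h
  rw [A, ← RatFunc.algebraMap_X, ← map_pow, ← map_one (algebraMap (Polynomial ℚ) (RatFunc ℚ))] at h
  have := RatFunc.algebraMap_injective ℚ h
  have h2 := congrArg Polynomial.natDegree this
  simp at h2
  exact hk h2

/-- The quantum integer formula, in a form free of denominators `q - q⁻¹`. -/
theorem eval_S_add_inv {F : Type} [Field F] {q : F} (hq : q ≠ 0) (n : ℕ) :
    (Polynomial.Chebyshev.S F (n : ℤ)).eval (q + q⁻¹) * (q - q⁻¹) = q ^ (n + 1) - q⁻¹ ^ (n + 1) := by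
  induction n using Nat.twoStepInduction with
  | zero => simp
  | one => simp; ring
  | more n h0 h1 =>
    have h := Polynomial.Chebyshev.S_add_two F (n : ℤ)
    push_cast at *
    rw [h]
    simp only [Polynomial.eval_sub, Polynomial.eval_mul, Polynomial.eval_X]
    rw [sub_mul, mul_assoc, h1, h0]
    have hqq : q * q⁻¹ = 1 := mul_inv_cancel₀ hq
    linear_combination (q ^ (n + 1) - q⁻¹ ^ (n + 1)) * hqq

/-- With `q = -A²`, a zero of `Δ_n` would give `q ^ (2 (n + 1)) = 1`, that is `A ^ (4 (n + 1)) = 1`,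
although `A` is an indeterminate. -/
theorem Delta_ne_zero (n : ℕ) : Delta n ≠ 0 := by
  intro h
  have hq : -A ^ 2 ≠ 0 := neg_ne_zero.2 (pow_ne_zero _ A_ne_zero)
  have h1 := eval_S_add_inv hq n
  rw [show -A ^ 2 + (-A ^ 2)⁻¹ = loopValue by rw [loopValue, inv_neg, inv_pow]; ring] at h1
  rw [Delta] at h
  rw [h, zero_mul, eq_comm, sub_eq_zero, inv_pow, ← mul_eq_one_iff_eq_inv₀ (pow_ne_zero _ hq),
    ← mul_pow] at h1
  refine A_pow_ne_one (k := 4 * (n + 1)) (by omega) ?_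
  rw [pow_mul, ← h1]
  ring

theorem Delta_zero : Delta 0 = 1 := by simp [Delta]

theorem Delta_one : Delta 1 = loopValue := by simp [Delta]

theorem Delta_add_two (n : ℕ) : Delta (n + 2) = loopValue * Delta (n + 1) - Delta n := by
  have h := Polynomial.Chebyshev.S_add_two K (n : ℤ)
  simp only [Delta]
  push_cast
  rw [h]
  simp

theorem jonesWenzl_add_two (n : ℕ) : jonesWenzl (n + 2) = jonesWenzl (n + 1) -
    (Delta n / Delta (n + 1)) •
      (jonesWenzl (n + 1) * ofWord [cap n, cup n] * jonesWenzl (n + 1)) := rfl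

theorem jonesWenzl_mem_tangles (n : ℕ) : jonesWenzl n ∈ tangles n n := by
  induction n using Nat.twoStepInduction with
  | zero => exact one_mem_tangles 0
  | one => exact one_mem_tangles 1
  | more n h0 h1 =>
    rw [jonesWenzl_add_two]
    have h := tangles_mono h1 1
    have he : ofWord [cap n, cup n] ∈ tangles (n + 2) (n + 2) :=
      ofWord_mem_tangles (isTangle_cap_cup.2 ⟨le_rfl, le_rfl, rfl⟩)
    exact sub_mem h (Submodule.smul_mem _ _ (mul_mem_tangles (mul_mem_tangles h he) h))

/-- The algebra generated by the hooks on `n` strands. -/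
def hooks (n : ℕ) : Subalgebra K Formal :=
  Algebra.adjoin K {y | ∃ a, a + 1 < n ∧ y = ofWord [cap a, cup a]}

theorem hook_mem_hooks {a n : ℕ} (h : a + 1 < n) : ofWord [cap a, cup a] ∈ hooks n :=
  Algebra.subset_adjoin ⟨a, h, rfl⟩

theorem hooks_mono {m n : ℕ} (h : m ≤ n) : hooks m ≤ hooks n :=
  Algebra.adjoin_mono fun _ ⟨a, ha, hy⟩ => ⟨a, ha.trans_le h, hy⟩

theorem jonesWenzl_mem_hooks (n : ℕ) : jonesWenzl n ∈ hooks n := by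
  induction n using Nat.twoStepInduction with
  | zero => exact one_mem _
  | one => exact one_mem _
  | more n h0 h1 =>
    have h := hooks_mono (Nat.le_succ _) h1
    rw [jonesWenzl_add_two]
    exact sub_mem h (Subalgebra.smul_mem _
      (mul_mem (mul_mem h (hook_mem_hooks (Nat.lt_succ_self _))) h) _)

/-- The right ideal of the algebra of hooks that is generated by the hooks. -/
def hookIdeal (n : ℕ) : Submodule K Formal :=
  Submodule.span K {z | ∃ a, a + 1 < n ∧ ∃ y ∈ hooks n, z = ofWord [cap a, cup a] * y}

theorem hookIdeal_mono {m n : ℕ} (h : m ≤ n) : hookIdeal m ≤ hookIdeal n :=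
  Submodule.span_mono fun _ ⟨a, ha, y, hy, hz⟩ => ⟨a, ha.trans_le h, y, hooks_mono h hy, hz⟩

theorem mul_mem_hookIdeal {n : ℕ} {z y : Formal} (hz : z ∈ hookIdeal n) (hy : y ∈ hooks n) :
    z * y ∈ hookIdeal n := by
  induction hz using Submodule.span_induction with
  | mem z h =>
    obtain ⟨a, ha, x, hx, rfl⟩ := h
    rw [mul_assoc]
    exact Submodule.subset_span ⟨a, ha, _, mul_mem hx hy, rfl⟩
  | zero => simp
  | add a b _ _ ha hb => rw [add_mul]; exact add_mem ha hb
  | smul r a _ ha => rw [smul_mul_assoc]; exact Submodule.smul_mem _ _ ha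

/-- It matters that the hook comes first, at the bottom: there it can act on a vector killed by all
maxima, or be carried around an adjacent minimum. -/
theorem jonesWenzl_sub_one_mem (n : ℕ) : jonesWenzl n - 1 ∈ hookIdeal n := by
  induction n using Nat.twoStepInduction with
  | zero => simp [jonesWenzl]
  | one => simp [jonesWenzl]
  | more n h0 h1 =>
    have hf := hooks_mono (Nat.le_succ _) (jonesWenzl_mem_hooks (n + 1))
    have h := hookIdeal_mono (Nat.le_succ _) h1
    have he : ofWord [cap n, cup n] * jonesWenzl (n + 1) ∈ hookIdeal (n + 2) :=
      Submodule.subset_span ⟨n, Nat.lt_succ_self _, _, hf, rfl⟩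
    have h2 := mul_mem_hookIdeal h (mul_mem (hook_mem_hooks (Nat.lt_succ_self (n + 1))) hf)
    have h3 := sub_mem h (Submodule.smul_mem _ (Delta n / Delta (n + 1)) (add_mem h2 he))
    convert h3 using 1
    rw [jonesWenzl_add_two, sub_mul, one_mul, sub_add_cancel, mul_assoc]
    abel

namespace TLRep

variable {R : Type} [Ring R] [Algebra K R] (T : TLRep R)

/-- The image of the Jones-Wenzl projector. -/
def jw (n : ℕ) : R := T.eval (jonesWenzl n)

@[simp] theorem eval_hook (a : ℕ) : T.eval (ofWord [cap a, cup a]) = T.u a := by simp [u]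

theorem jw_add_two (n : ℕ) : T.jw (n + 2) = T.jw (n + 1) -
    (Delta n / Delta (n + 1)) • (T.jw (n + 1) * T.u n * T.jw (n + 1)) := by
  simp only [jw, jonesWenzl_add_two, map_sub, map_smul, map_mul, eval_hook]

theorem jw_zero : T.jw 0 = 1 := map_one _

theorem jw_one : T.jw 1 = 1 := map_one _

theorem jw_mul_u {n k : ℕ} (h : n ≤ k) : T.jw n * T.u k = T.u k * T.jw n := by
  obtain ⟨j, rfl⟩ := Nat.exists_eq_add_of_le h
  have := T.eval_mul_eval_shift (jonesWenzl_mem_tangles n) (ofWord [cap j, cup j])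
  simpa only [shift_ofWord, List.map_cons, List.map_nil, shift_cap, shift_cup, eval_hook, jw]
    using this

/-- The properties are proved together because each step of the recursion uses all of them. The
third is the partial trace formula. Its factor `Δ_(n+1) / Δ_n` is inverse to the coefficient in the
recursion, which gives idempotence and the vanishing on the new hook; the recursion of the `Δ_n`
carries the formula on to the next projector. -/
theorem jw_spec (n : ℕ) : T.jw (n + 1) * T.jw (n + 1) = T.jw (n + 1) ∧
    (∀ a < n, T.u a * T.jw (n + 1) = 0 ∧ T.jw (n + 1) * T.u a = 0) ∧
    T.u n * T.jw (n + 1) * T.u n = (Delta (n + 1) / Delta n) • (T.jw n * T.u n) ∧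
    T.jw n * T.jw (n + 1) = T.jw (n + 1) ∧ T.jw (n + 1) * T.jw n = T.jw (n + 1) := by
  induction n with
  | zero =>
    simp [jw_zero, jw_one, u_mul_u, Delta_zero, Delta_one]
  | succ n ih =>
    obtain ⟨hff, hk, hp, ha, ha'⟩ := ih
    have he : T.u n * T.jw n = T.jw n * T.u n := (T.jw_mul_u le_rfl).symm
    have he' : T.jw (n + 1) * T.u (n + 1) = T.u (n + 1) * T.jw (n + 1) := T.jw_mul_u le_rfl
    have hr := T.jw_add_two n
    have hΔ := Delta_add_two n
    have hD := Delta_ne_zero n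
    have hD' := Delta_ne_zero (n + 1)
    have huuu : T.u (n + 1) * T.u n * T.u (n + 1) = T.u (n + 1) := T.u_succ_mul_u_mul_u_succ n
    have huu := T.u_mul_u (n + 1)
    have hμ : Delta n / Delta (n + 1) * (Delta (n + 1) / Delta n) = 1 := by field_simp
    have hδ : Delta (n + 2) / Delta (n + 1) = loopValue - Delta n / Delta (n + 1) := by
      rw [hΔ]; field_simp
    rw [show n + 1 + 1 = n + 2 from rfl, hr, hδ]
    generalize T.jw (n + 1) = f at *
    generalize T.jw n = g at *
    generalize hu : T.u n = e at *
    generalize T.u (n + 1) = e' at *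
    generalize Delta n / Delta (n + 1) = μ at *
    generalize Delta (n + 1) / Delta n = ν at *
    -- The partial trace formula turns `e f e` into a multiple of `g e = e g`, and then `f` absorbs
    -- `g`.
    have hefef : e * f * e * f = ν • (e * f) := by
      rw [hp, smul_mul_assoc, ← he, mul_assoc, ha]
    have hfefe : f * e * f * e = ν • (f * e) := by
      rw [mul_assoc f e, mul_assoc f, hp, mul_smul_comm, ← mul_assoc, ha']
    have hfef : f * (e * f) * (f * (e * f)) = ν • (f * e * f) := by
      have : f * (e * f) * (f * (e * f)) = f * (e * (f * f) * e * f) := by simp only [mul_assoc]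
      rw [this, hff, hefef, mul_smul_comm, mul_assoc]
    have hf1 : f * (f * e * f) = f * e * f := by rw [← mul_assoc, ← mul_assoc, hff]
    have hf2 : f * e * f * f = f * e * f := by rw [mul_assoc, hff]
    refine ⟨?_, ?_, ?_, ?_, ?_⟩
    · rw [sub_mul, mul_sub, mul_sub, hff, mul_smul_comm, smul_mul_assoc, hf1, hf2,
        smul_mul_smul_comm, mul_assoc f e f, hfef, smul_smul, mul_assoc, hμ, mul_one, ← mul_assoc]
      abel
    · intro a ha
      rcases Nat.lt_succ_iff_lt_or_eq.1 ha with h | rfl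
      · obtain ⟨h1, h2⟩ := hk a h
        constructor
        · rw [mul_sub, h1, mul_smul_comm, ← mul_assoc, ← mul_assoc, h1]; simp
        · rw [sub_mul, h2, smul_mul_assoc, mul_assoc, h2]; simp
      · constructor
        · rw [hu, mul_sub, mul_smul_comm, ← mul_assoc, ← mul_assoc, hefef, smul_smul, hμ, one_smul,
            sub_self]
        · rw [hu, sub_mul, smul_mul_assoc, hfefe, smul_smul, hμ, one_smul, sub_self]
    · have h1 : e' * (f * e * f) * e' = f * e' := by
        calc e' * (f * e * f) * e' = e' * f * e * (f * e') := by simp only [mul_assoc]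
          _ = f * e' * e * (e' * f) := by rw [he']
          _ = f * (e' * e * e') * f := by simp only [mul_assoc]
          _ = f * e' := by rw [huuu, mul_assoc, ← he', ← mul_assoc, hff]
      rw [mul_sub, sub_mul, ← he', mul_assoc, huu, mul_smul_comm, mul_smul_comm, smul_mul_assoc, h1,
        sub_smul]
    · rw [mul_sub, hff, mul_smul_comm, hf1]
    · rw [sub_mul, hff, smul_mul_assoc, hf2]

theorem jw_mul_jw (n : ℕ) : T.jw n * T.jw n = T.jw n := by
  cases n with
  | zero => simp [jw_zero]
  | succ n => exact (T.jw_spec n).1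

theorem u_mul_jw {a n : ℕ} (h : a + 1 < n) : T.u a * T.jw n = 0 := by
  obtain ⟨n, rfl⟩ := Nat.exists_eq_add_of_le' (show 1 ≤ n by omega)
  exact ((T.jw_spec n).2.1 a (by omega)).1

theorem jw_mul_u_eq_zero {a n : ℕ} (h : a + 1 < n) : T.jw n * T.u a = 0 := by
  obtain ⟨n, rfl⟩ := Nat.exists_eq_add_of_le' (show 1 ≤ n by omega)
  exact ((T.jw_spec n).2.1 a (by omega)).2

/-- The recursion is symmetric under reflection in a horizontal line. So facts about projectors at
minima transfer to maxima. -/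
theorem dual_jw (n : ℕ) : T.dual.jw n = MulOpposite.op (T.jw n) := by
  induction n using Nat.twoStepInduction with
  | zero => simp [jw_zero]
  | one => simp [jw_one]
  | more n h0 h1 =>
    rw [jw_add_two, jw_add_two, h1]
    simp [mul_assoc]

theorem jw_mul_d {a n : ℕ} (h : a + 1 < n) : T.jw n * T.d a = 0 := by
  rw [← T.u_mul_d_succ a, ← mul_assoc, jw_mul_u_eq_zero T h, zero_mul]

/-- The composition of a tangle with projectors at both ends is a multiple of the projector. -/
theorem exists_jw_mul_eval_mul_jw {n : ℕ} {y : Formal} (hy : y ∈ tangles n n) :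
    ∃ r : K, ∀ (R : Type) [Ring R] [Algebra K R] (T : TLRep R),
      T.jw n * T.eval y * T.jw n = r • T.jw n := by
  -- The scalar is read off from a normal form of `y` before any representation is chosen, so one
  -- value serves all representations and all positions. A nonempty normal form begins with a
  -- maximum, which the projector kills; only the identity tangle contributes.
  have hr := tangles_le_reducible n n hy
  rw [reducible, Submodule.mem_sup] at hr
  obtain ⟨y, hrel, z, hz, rfl⟩ := hr
  have h0 : ∀ (R : Type) [Ring R] [Algebra K R] (T : TLRep R), T.eval y = 0 := by
    intro R _ _ T
    suffices H : Submodule.span K {y | LocalRelator n n y} ≤ LinearMap.ker T.eval.toLinearMap from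
      H hrel
    exact Submodule.span_le.2 fun y hy => T.eval_localRelator hy
  simp only [map_add, h0, zero_add]
  clear h0 hrel hy
  induction hz using Submodule.span_induction with
  | mem z h =>
    obtain ⟨w, hw, ⟨a, b, rfl, ha, hb⟩, rfl⟩ := h
    obtain ⟨p, hpa, hpb⟩ := isTangle_append.1 hw
    have ea := isTangle_of_forall_cap ha hpa
    rcases a with _ | ⟨s, a⟩
    · have eb := isTangle_of_forall_cup hb hpb
      obtain rfl : b = [] := by
        rw [← List.length_eq_zero_iff]
        simp at ea
        omega
      exact ⟨1, fun R _ _ T => by simp [jw_mul_jw]⟩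
    · obtain ⟨i, rfl⟩ := ha s (by simp)
      refine ⟨0, fun R _ _ T => ?_⟩
      have hi : i + 2 ≤ n := hpa.1
      simp only [eval_ofWord, List.cons_append, word_cons, slice_cap, ← mul_assoc,
        jw_mul_d T (show i + 1 < n by omega), zero_mul, zero_smul]
  | zero => exact ⟨0, by simp⟩
  | add a b _ _ ha hb =>
    obtain ⟨r, hr⟩ := ha
    obtain ⟨s, hs⟩ := hb
    exact ⟨r + s, fun R _ _ T => by rw [map_add, mul_add, add_mul, hr, hs, add_smul]⟩
  | smul c a _ ha =>
    obtain ⟨r, hr⟩ := ha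
    exact ⟨c * r, fun R _ _ T => by
      rw [map_smul, mul_smul_comm, smul_mul_assoc, hr, mul_smul]⟩

end TLRep

/-- The constant spin sequence is killed by every maximum, hence by everything in `hookIdeal n`; so
the projector fixes it. -/
theorem spinRep_shift_jw_ne_zero (n N : ℕ) : (spinRep.shift N).jw n ≠ 0 := by
  have h : ∀ z ∈ hookIdeal n, ((spinRep.shift N).eval z).unop (Finsupp.single (fun _ => true) 1) = 0 := by
    intro z hz
    induction hz using Submodule.span_induction with
    | mem z h =>
      obtain ⟨a, ha, y, hy, rfl⟩ := h
      rw [map_mul, TLRep.eval_hook, TLRep.u, mul_assoc]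
      change ((spinRep.shift N).c a * (spinRep.shift N).eval y).unop (capOp (N + a) (Finsupp.single (fun _ => true) 1)) = 0
      rw [capOp_const, map_zero]
    | zero => simp
    | add a b _ _ ha hb => simp [ha, hb]
    | smul r a _ ha => simp [ha]
  intro h0
  have h1 := h _ (jonesWenzl_sub_one_mem n)
  rw [map_sub, map_one, show (spinRep.shift N).eval (jonesWenzl n) = 0 from h0] at h1
  simp at h1

/-! ### Cables -/

namespace TLRep

variable {R : Type} [Ring R] [Algebra K R] (T : TLRep R)

theorem c_mul_u_far (i k : ℕ) : T.c i * T.u (i + 2 + k) = T.u (i + k) * T.c i := by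
  rw [u, u, ← mul_assoc, T.cd, mul_assoc, T.cc, mul_assoc]

theorem u_mul_c_far (i k : ℕ) : T.u i * T.c (i + 2 + k) = T.c (i + 2 + k) * T.u i := by
  rw [u, mul_assoc, T.cc, ← mul_assoc, T.dc, mul_assoc]

theorem c_mul_x_far (e : Bool) (i k : ℕ) : T.c i * T.x e (i + 2 + k) = T.x e (i + k) * T.c i :=
  T.slice_far .cup (.crossing e) i k

theorem x_mul_c_far (e : Bool) {i j : ℕ} (h : i + 2 ≤ j) :
    T.x e i * T.c j = T.c j * T.x e i := by
  obtain ⟨k, rfl⟩ := Nat.exists_eq_add_of_le h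
  exact T.slice_far (.crossing e) .cup i k

theorem commute_x_x {e e' : Bool} {i j : ℕ} (h : i + 2 ≤ j) : Commute (T.x e i) (T.x e' j) := by
  obtain ⟨k, rfl⟩ := Nat.exists_eq_add_of_le h
  exact T.slice_far (.crossing e) (.crossing e') i k

theorem commute_u_u {i j : ℕ} (h : i + 2 ≤ j) : Commute (T.u i) (T.u j) := by
  obtain ⟨k, rfl⟩ := Nat.exists_eq_add_of_le h
  rw [Commute, SemiconjBy, show T.u i = T.d i * T.c i from rfl, mul_assoc, c_mul_u_far, u, u, ← mul_assoc, ← mul_assoc, T.dd,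
    mul_assoc _ (T.d i), T.dc, mul_assoc, mul_assoc, mul_assoc]

theorem commute_u_x {e : Bool} {i j : ℕ} (h : i + 2 ≤ j) : Commute (T.u i) (T.x e j) :=
  ((Commute.one_right _).smul_right _).add_right ((commute_u_u T h).smul_right _)

theorem commute_x_u {e : Bool} {i j : ℕ} (h : i + 2 ≤ j) : Commute (T.x e i) (T.u j) :=
  ((Commute.one_left _).smul_left _).add_left ((commute_u_u T h).smul_left _)

/-- Nested minima. -/
def cups (N n : ℕ) : R := ((List.range n).map fun a => T.c (N + a)).prod

/-- Nested maxima. -/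
def caps (N n : ℕ) : R := ((List.range n).map fun a => T.d (N + a)).reverse.prod

/-- A strand crossing `n` strands from left to right. -/
def row (e : Bool) (N n : ℕ) : R := ((List.range n).map fun b => T.x e (N + b)).prod

/-- A strand crossing `m` strands from right to left. -/
def col (e : Bool) (N m : ℕ) : R := ((List.range m).map fun a => T.x e (N + a)).reverse.prod

/-- The crossings of `m` parallel strands with `n` parallel strands. -/
def grid (e : Bool) (N m n : ℕ) : R :=
  ((List.range m).reverse.flatMap fun a => (List.range n).map fun b => T.x e (N + a + b)).prod

@[simp] theorem cups_zero (N : ℕ) : T.cups N 0 = 1 := rfl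
@[simp] theorem caps_zero (N : ℕ) : T.caps N 0 = 1 := rfl
@[simp] theorem row_zero (e : Bool) (N : ℕ) : T.row e N 0 = 1 := rfl
@[simp] theorem col_zero (e : Bool) (N : ℕ) : T.col e N 0 = 1 := rfl
@[simp] theorem grid_zero_left (e : Bool) (N n : ℕ) : T.grid e N 0 n = 1 := rfl

theorem cups_succ (N n : ℕ) : T.cups N (n + 1) = T.cups N n * T.c (N + n) := by
  simp [cups, List.range_succ]

theorem cups_succ' (N n : ℕ) : T.cups N (n + 1) = T.c N * T.cups (N + 1) n := by
  simp only [cups, List.range_succ_eq_map, List.map_cons, List.map_map, List.prod_cons, add_zero]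
  congr 3
  funext a
  simp only [Function.comp_apply]
  congr 1
  omega

theorem cups_add (N m n : ℕ) : T.cups N (m + n) = T.cups N m * T.cups (N + m) n := by
  induction n with
  | zero => simp
  | succ n ih => rw [← add_assoc, cups_succ, ih, cups_succ, mul_assoc, add_assoc]

theorem caps_succ (N n : ℕ) : T.caps N (n + 1) = T.d (N + n) * T.caps N n := by
  simp [caps, List.range_succ]

theorem row_succ (e : Bool) (N n : ℕ) : T.row e N (n + 1) = T.row e N n * T.x e (N + n) := by
  simp [row, List.range_succ]

theorem col_succ (e : Bool) (N n : ℕ) : T.col e N (n + 1) = T.x e (N + n) * T.col e N n := by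
  simp [col, List.range_succ]

theorem col_succ' (e : Bool) (N n : ℕ) : T.col e N (n + 1) = T.col e (N + 1) n * T.x e N := by
  induction n with
  | zero => simp [col_succ]
  | succ n ih => rw [col_succ, ih, col_succ, mul_assoc, show N + 1 + n = N + (n + 1) by omega]

theorem grid_succ_left (e : Bool) (N m n : ℕ) :
    T.grid e N (m + 1) n = T.row e (N + m) n * T.grid e N m n := by
  simp [grid, row, List.range_succ]

theorem grid_zero_right (e : Bool) (N m : ℕ) : T.grid e N m 0 = 1 := by
  induction m with
  | zero => rfl
  | succ m ih => rw [grid_succ_left, ih, row_zero, one_mul]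

@[simp] theorem dual_cups (N n : ℕ) : T.dual.cups N n = MulOpposite.op (T.caps N n) := by
  induction n with
  | zero => simp
  | succ n ih => simp [cups_succ, caps_succ, ih]

@[simp] theorem dual_caps (N n : ℕ) : T.dual.caps N n = MulOpposite.op (T.cups N n) := by
  induction n with
  | zero => simp
  | succ n ih => simp [cups_succ, caps_succ, ih]

@[simp] theorem dual_row (e : Bool) (N n : ℕ) :
    T.dual.row e N n = MulOpposite.op (T.col e N n) := by
  induction n with
  | zero => simp
  | succ n ih => simp [row_succ, col_succ, ih]

theorem commute_row_x {e e' : Bool} {N n k : ℕ} (h : N + n + 1 ≤ k) :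
    Commute (T.row e N n) (T.x e' k) := by
  induction n with
  | zero => exact Commute.one_left _
  | succ n ih =>
    rw [row_succ]
    exact (ih (by omega)).mul_left (commute_x_x T (by omega))

theorem commute_row_u {e : Bool} {N n k : ℕ} (h : N + n + 1 ≤ k) :
    Commute (T.row e N n) (T.u k) := by
  induction n with
  | zero => exact Commute.one_left _
  | succ n ih =>
    rw [row_succ]
    exact (ih (by omega)).mul_left (commute_x_u T (by omega))

theorem row_mul_c {e : Bool} {N n k : ℕ} (h : N + n + 1 ≤ k) :
    T.row e N n * T.c k = T.c k * T.row e N n := by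
  induction n with
  | zero => simp
  | succ n ih =>
    rw [row_succ, mul_assoc, x_mul_c_far T e (by omega), ← mul_assoc, ih (by omega), mul_assoc]

theorem commute_grid_x {e e' : Bool} {N m n k : ℕ} (h : N + m + n ≤ k) :
    Commute (T.grid e N m n) (T.x e' k) := by
  induction m with
  | zero => exact Commute.one_left _
  | succ m ih =>
    rw [grid_succ_left]
    exact (commute_row_x T (by omega)).mul_left (ih (by omega))

theorem commute_grid_col {e e' : Bool} {N m n k l : ℕ} (h : N + m + n ≤ k) :
    Commute (T.grid e N m n) (T.col e' k l) := by
  induction l with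
  | zero => exact Commute.one_right _
  | succ l ih =>
    rw [col_succ]
    exact (commute_grid_x T (by omega)).mul_right ih

/-- The grid is defined row by row; exchanging distant crossings allows it to be built column by
column too. -/
theorem grid_succ_right (e : Bool) (N m n : ℕ) :
    T.grid e N m (n + 1) = T.grid e N m n * T.col e (N + n) m := by
  induction m with
  | zero => simp
  | succ m ih =>
    rw [grid_succ_left, grid_succ_left, ih, row_succ, col_succ, mul_assoc, mul_assoc,
      show N + m + n = N + n + m by omega, ← mul_assoc (T.x e (N + n + m)),
      ← (commute_grid_x T (show N + m + n ≤ N + n + m by omega)).eq, mul_assoc]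

theorem grid_add_right (e : Bool) (N m n l : ℕ) :
    T.grid e N m (n + l) = T.grid e N m n * T.grid e (N + n) m l := by
  induction l with
  | zero => simp [grid_zero_right]
  | succ l ih => rw [← add_assoc, grid_succ_right, ih, grid_succ_right, mul_assoc, add_assoc]

@[simp] theorem dual_grid (e : Bool) (N m n : ℕ) :
    T.dual.grid e N m n = MulOpposite.op (T.grid e N n m) := by
  induction m with
  | zero => simp [grid_zero_right]
  | succ m ih => rw [grid_succ_left, ih, dual_row, grid_succ_right, MulOpposite.op_mul]

theorem col_mul_row (e : Bool) (N n : ℕ) : T.col e N n * T.row (!e) N n = 1 := by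
  induction n with
  | zero => simp
  | succ n ih =>
    rw [col_succ, row_succ, mul_assoc, ← mul_assoc (T.col _ _ _), ih, one_mul, type_II]

theorem grid_mul_grid (e : Bool) (N m n : ℕ) : T.grid e N m n * T.grid (!e) N n m = 1 := by
  induction n with
  | zero => simp [grid_zero_right]
  | succ n ih =>
    rw [grid_succ_right, grid_succ_left, mul_assoc, ← mul_assoc (T.col _ _ _), col_mul_row, one_mul,
      ih]

theorem c_succ_mul_x_mul_x (e : Bool) (k : ℕ) :
    T.c (k + 1) * T.x e k * T.x e (k + 1) = T.c k := by
  have h := T.turn_cup (!e) k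
  have h2 := T.type_II (!e) (k + 1)
  rw [Bool.not_not] at h h2
  rw [← h, mul_assoc, h2, mul_one]

theorem x_mul_x_mul_d (e : Bool) (k : ℕ) :
    T.x e k * (T.x e (k + 1) * T.d k) = T.d (k + 1) := by
  have h := T.turn_cap (!e) k
  rw [Bool.not_not] at h
  rw [← h, ← mul_assoc, T.type_II, one_mul]

/-- A hook slides along the two strands it joins, past a third strand crossing both. This is the
source of all sliding of projectors through crossings. -/
theorem u_succ_mul_x_mul_x (e : Bool) (k : ℕ) :
    T.u (k + 1) * (T.x e k * T.x e (k + 1)) = T.x e k * T.x e (k + 1) * T.u k := by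
  rw [u, u, mul_assoc, ← mul_assoc (T.c (k + 1)), c_succ_mul_x_mul_x, ← mul_assoc (_ * _),
    mul_assoc (T.x e k), x_mul_x_mul_d]

theorem u_mul_row {e : Bool} {N n a : ℕ} (h : a + 1 < n) :
    T.u (N + 1 + a) * T.row e N n = T.row e N n * T.u (N + a) := by
  induction n with
  | zero => omega
  | succ n ih =>
    rcases Nat.lt_succ_iff_lt_or_eq.1 h with h | rfl
    · rw [row_succ, ← mul_assoc, ih h, mul_assoc, mul_assoc, (commute_u_x T (by omega)).eq]
    · rw [row_succ, row_succ, mul_assoc, ← mul_assoc (T.u _),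
        ← (commute_row_u T (show N + a + 1 ≤ N + 1 + a by omega)).eq, mul_assoc, mul_assoc,
        show N + 1 + a = N + a + 1 by omega, show N + (a + 1) = N + a + 1 by omega,
        u_succ_mul_x_mul_x]

theorem u_mul_grid {e : Bool} {N m n a : ℕ} (h : a + 1 < n) :
    T.u (N + m + a) * T.grid e N m n = T.grid e N m n * T.u (N + a) := by
  induction m with
  | zero => simp
  | succ m ih =>
    rw [grid_succ_left, ← mul_assoc, show N + (m + 1) + a = N + m + 1 + a by omega,
      u_mul_row T h, mul_assoc, ih, mul_assoc]

/-- Conjugation of `u_mul_grid` by the inverse grid, in which the two bands have changed places. -/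
theorem u_mul_grid_left {e : Bool} {N m n a : ℕ} (h : a + 1 < m) :
    T.u (N + a) * T.grid e N m n = T.grid e N m n * T.u (N + n + a) := by
  have h1 := T.u_mul_grid (e := !e) (N := N) (m := n) h
  have h2 := T.grid_mul_grid e N m n
  have h3 := T.grid_mul_grid (!e) N n m
  rw [Bool.not_not] at h3
  calc T.u (N + a) * T.grid e N m n
      = T.grid e N m n * (T.grid (!e) N n m * T.u (N + a)) * T.grid e N m n := by
        rw [← mul_assoc, h2, one_mul]
    _ = T.grid e N m n * T.u (N + n + a) * (T.grid (!e) N n m * T.grid e N m n) := by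
        rw [← h1]; simp only [mul_assoc]
    _ = T.grid e N m n * T.u (N + n + a) := by rw [h3, mul_one]

theorem x_mul_of_u_mul {y : R} {i j : ℕ} (h : T.u i * y = y * T.u j) (e : Bool) :
    T.x e i * y = y * T.x e j := by
  simp only [x, add_mul, mul_add, smul_mul_assoc, mul_smul_comm, h, one_mul, mul_one]

theorem grid_mul_of_u_mul {y : R} {i j n : ℕ}
    (h : ∀ a, a + 1 < n → T.u (i + a) * y = y * T.u (j + a)) (e : Bool) {p q : ℕ}
    (hpq : p + q ≤ n) : T.grid e i p q * y = y * T.grid e j p q := by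
  have hrow : ∀ p q, p + q < n → T.row e (i + p) q * y = y * T.row e (j + p) q := by
    intro p q hpq
    induction q with
    | zero => simp
    | succ q ih =>
      have := T.x_mul_of_u_mul (h (p + q) (by omega)) e
      rw [row_succ, row_succ, mul_assoc, add_assoc i, this, ← mul_assoc, ih (by omega), mul_assoc,
        add_assoc j]
  induction p with
  | zero => simp
  | succ p ih =>
    rw [grid_succ_left, grid_succ_left, mul_assoc, ih (by omega), ← mul_assoc,
      hrow p q (by omega), mul_assoc]

/-- Two of the three grids merge into one band crossing `2n` strands. Hooks on these strands slide
through that grid, and the third grid is built from such hooks. -/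
theorem grid_type_III (e : Bool) (N n : ℕ) :
    T.grid e N n n * T.grid e (N + n) n n * T.grid e N n n =
      T.grid e (N + n) n n * T.grid e N n n * T.grid e (N + n) n n := by
  rw [mul_assoc (T.grid e (N + n) n n), ← grid_add_right]
  refine (T.grid_mul_of_u_mul (n := n + n) (fun a ha => ?_) e le_rfl).symm
  exact T.u_mul_grid ha

/-! ### Cables of minima and maxima -/

theorem c_mul_col (e : Bool) (i k m : ℕ) :
    T.c i * T.col e (i + 2 + k) m = T.col e (i + k) m * T.c i := by
  induction m with
  | zero => simp
  | succ m ih =>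
    rw [col_succ, ← mul_assoc, add_assoc (i + 2), c_mul_x_far, mul_assoc, ih, col_succ, mul_assoc,
      add_assoc i]

/-- A strand crossing the right legs of nested minima is pulled below them to cross the left legs;
the induction turns one minimum at a time. -/
theorem cups_mul_col (e : Bool) (N m : ℕ) :
    T.cups N m * T.col e (N + m) m = T.cups (N + 1) m * T.row (!e) N m := by
  induction m with
  | zero => simp
  | succ m ih =>
    have h1 : T.c (N + m) * T.col e (N + (m + 1) + 1) m = T.col e (N + m) m * T.c (N + m) :=
      T.c_mul_col e (N + m) 0 m
    calc T.cups N (m + 1) * T.col e (N + (m + 1)) (m + 1)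
        = T.cups N m * (T.c (N + m) * T.col e (N + (m + 1) + 1) m) * T.x e (N + (m + 1)) := by
          rw [cups_succ, col_succ']; simp only [mul_assoc]
      _ = T.cups N m * T.col e (N + m) m * (T.c (N + m) * T.x e (N + m + 1)) := by
          rw [h1]; simp only [mul_assoc]; rfl
      _ = T.cups (N + 1) m * (T.row (!e) N m * T.c (N + m + 1)) * T.x (!e) (N + m) := by
          rw [ih, turn_cup]; simp only [mul_assoc]
      _ = T.cups (N + 1) (m + 1) * T.row (!e) N (m + 1) := by
          rw [row_mul_c T le_rfl, cups_succ, row_succ, show N + 1 + m = N + m + 1 by omega]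
          simp only [mul_assoc]

theorem cups_mul_grid (e : Bool) (N m n : ℕ) :
    T.cups N m * T.grid e (N + m) m n = T.cups (N + n) m * T.grid (!e) N n m := by
  induction n with
  | zero => simp [grid_zero_right]
  | succ n ih =>
    rw [grid_succ_right, ← mul_assoc, ih, mul_assoc,
      (commute_grid_col T (show N + n + m ≤ N + m + n by omega)).eq,
      show N + m + n = N + n + m by omega, ← mul_assoc, cups_mul_col, mul_assoc, ← grid_succ_left,
      add_assoc N n 1]

theorem grid_mul_caps (e : Bool) (N n : ℕ) :
    T.grid e N n n * T.caps (N + n) n = T.grid (!e) (N + n) n n * T.caps N n := by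
  have h := T.dual.cups_mul_grid (!e) N n n
  simp only [dual_cups, dual_grid, ← MulOpposite.op_mul, Bool.not_not] at h
  exact (MulOpposite.op_injective h).symm

theorem cups_mul_d (M n : ℕ) : T.cups (M + 2) n * T.d M = T.d M * T.cups M n := by
  induction n with
  | zero => simp
  | succ n ih => rw [cups_succ, mul_assoc, ← T.dc, ← mul_assoc, ih, cups_succ, mul_assoc]

theorem cups_mul_caps_left (N n : ℕ) : T.cups (N + n) n * T.caps N n = 1 := by
  induction n with
  | zero => simp
  | succ n ih =>
    have h : T.cups (N + (n + 1) + 1) n * T.d (N + n) = T.d (N + n) * T.cups (N + n) n :=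
      T.cups_mul_d (N + n) n
    rw [cups_succ', caps_succ, mul_assoc, ← mul_assoc (T.cups _ _), h, mul_assoc, ih, mul_one]
    exact T.zigzag_left _

theorem cups_mul_caps_right (N n : ℕ) : T.cups N n * T.caps (N + n) n = 1 := by
  have h := T.dual.cups_mul_caps_left N n
  simp only [dual_cups, dual_caps, ← MulOpposite.op_mul] at h
  exact MulOpposite.op_injective h

theorem cups_mul_u_far (N n k : ℕ) :
    T.cups N n * T.u (N + 2 * n + k) = T.u (N + k) * T.cups N n := by
  induction n with
  | zero => simp
  | succ n ih =>
    rw [cups_succ, mul_assoc, show N + 2 * (n + 1) + k = N + n + 2 + (n + k) by omega, c_mul_u_far,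
      ← mul_assoc, show N + n + (n + k) = N + 2 * n + k by omega, ih, mul_assoc]

theorem u_mul_cups_far (M n : ℕ) : T.u M * T.cups (M + 2) n = T.cups (M + 2) n * T.u M := by
  induction n with
  | zero => simp
  | succ n ih => rw [cups_succ, ← mul_assoc, ih, mul_assoc, u_mul_c_far, mul_assoc]

/-- The hook joins the left legs of two neighbouring minima and passes to their right legs; the
order of the legs is reversed there, hence `n - 2 - a`. The `k` minima nested inside these two put
`2 * k` strands between the two places. -/
theorem cups_mul_u {N n a : ℕ} (h : a + 1 < n) :
    T.cups N n * T.u (N + a) = T.cups N n * T.u (N + n + (n - 2 - a)) := by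
  obtain ⟨k, rfl⟩ := Nat.exists_eq_add_of_le (show a + 2 ≤ n by omega)
  have hN : N + (a + 2 + k) + (a + 2 + k - 2 - a) = N + a + 2 + 2 * k + 0 := by omega
  have h1 : T.c (N + a) * T.c (N + a + 1) * T.u (N + a) =
      T.c (N + a) * T.c (N + a + 1) * T.u (N + a + 2) := by
    have hc : T.c (N + a) * T.c (N + a + 2) = T.c (N + a) * T.c (N + a) := T.cc (N + a) 0
    rw [mul_assoc, c_succ_mul_u, mul_assoc, show N + a + 2 = N + a + 1 + 1 from rfl, c_mul_u_succ]
    exact hc.symm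
  have h2 : T.cups (N + a) 2 = T.c (N + a) * T.c (N + a + 1) := by simp [cups_succ]
  have h3 := T.cups_mul_u_far (N + a + 2) k 0
  have h4 := T.u_mul_cups_far (N + a) k
  rw [add_zero (N + a + 2)] at h3
  rw [hN, cups_add, cups_add, h2, ← add_assoc N a 2]
  calc T.cups N a * (T.c (N + a) * T.c (N + a + 1)) * T.cups (N + a + 2) k * T.u (N + a)
      = T.cups N a * (T.c (N + a) * T.c (N + a + 1) * T.u (N + a)) * T.cups (N + a + 2) k := by
        rw [mul_assoc, ← h4]; simp only [mul_assoc]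
    _ = T.cups N a * (T.c (N + a) * T.c (N + a + 1)) *
        (T.u (N + a + 2) * T.cups (N + a + 2) k) := by
        rw [h1]; simp only [mul_assoc]
    _ = _ := by rw [← h3]; simp only [mul_assoc]

end TLRep

/-! ### Cabled slices -/

theorem cable_add (n i k : ℕ) (g : Piece) :
    cable n ⟨g, i + k⟩ = (cable n ⟨g, k⟩).map (Slice.shift (n * i)) := by
  rcases g with _ | _ | e
  · simp [cable, Function.comp_def, mul_add, add_assoc]
  · simp [cable, Function.comp_def, mul_add, add_assoc, List.map_reverse]
  · simp [cable, Function.comp_def, mul_add, add_assoc, List.map_flatMap]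

theorem isTangle_cups {N p n : ℕ} (h : N ≤ p) :
    IsTangle p ((List.range n).map fun a => cup (N + a)) (p + 2 * n) := by
  induction n with
  | zero => exact rfl
  | succ n ih =>
    rw [List.range_succ, List.map_append]
    refine ih.append ⟨?_, ?_⟩
    · simp only [cup, Piece.inputs]; omega
    · simp only [cup, Piece.inputs, Piece.outputs, List.map_nil, IsTangle]; omega

theorem isTangle_caps {N p n : ℕ} (h : N ≤ p) :
    IsTangle (p + 2 * n) ((List.range n).map fun a => cap (N + a)).reverse p := by
  induction n with
  | zero => exact rfl
  | succ n ih =>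
    rw [List.range_succ, List.map_append, List.reverse_append]
    refine ⟨?_, ?_⟩
    · simp only [cap, Piece.inputs]; omega
    · have e : p + 2 * (n + 1) - (cap (N + n)).piece.inputs + (cap (N + n)).piece.outputs =
          p + 2 * n := by
        simp only [cap, Piece.inputs, Piece.outputs]; omega
      exact e ▸ ih

theorem isTangle_crossings {p : ℕ} {w : List Slice}
    (h : ∀ s ∈ w, ∃ e i, s = cross e i ∧ i + 2 ≤ p) : IsTangle p w p := by
  induction w with
  | nil => exact rfl
  | cons s w ih =>
    obtain ⟨e, i, rfl, hi⟩ := h s (by simp)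
    refine ⟨hi, ?_⟩
    convert ih fun s hs => h s (by simp [hs]) using 1
    simp only [cross, Piece.inputs, Piece.outputs]
    omega

theorem isTangle_cable (n i : ℕ) (g : Piece) :
    IsTangle (n * (i + g.inputs)) (cable n ⟨g, i⟩) (n * (i + g.outputs)) := by
  rcases g with _ | _ | e
  · have h := isTangle_cups (n := n) (le_refl (n * i))
    rwa [show n * i + 2 * n = n * (i + 2) by ring] at h
  · have h := isTangle_caps (n := n) (le_refl (n * i))
    rwa [show n * i + 2 * n = n * (i + 2) by ring] at h
  · refine isTangle_crossings fun s hs => ?_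
    simp only [cable, List.mem_flatMap, List.mem_reverse, List.mem_map, List.mem_range] at hs
    obtain ⟨a, ha, b, hb, rfl⟩ := hs
    refine ⟨e, _, rfl, ?_⟩
    simp only [Piece.inputs, mul_add]
    omega

theorem isTangle_cable_slice {n p : ℕ} {s : Slice} (h : s.pos + s.piece.inputs ≤ p) :
    IsTangle (n * p) (cable n s) (n * (p - s.piece.inputs + s.piece.outputs)) := by
  obtain ⟨k, rfl⟩ := Nat.exists_eq_add_of_le h
  convert (isTangle_cable n s.pos s.piece).mono (n * k) using 1
  · ring
  · rw [← mul_add]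
    congr 1
    omega

theorem shift_shift (a b : ℕ) (y : Formal) : shift a (shift b y) = shift (a + b) y := by
  induction y using Formal.induction with
  | zero => simp
  | add x y hx hy => simp only [map_add, hx, hy]
  | word r w =>
    simp only [shift_smul, shift_ofWord, List.map_map]
    congr 3
    funext s
    simp [Slice.shift, add_assoc]

theorem hooks_le_tangles {n : ℕ} {y : Formal} (hy : y ∈ hooks n) : y ∈ tangles n n := by
  induction hy using Algebra.adjoin_induction with
  | mem y h =>
    obtain ⟨a, ha, rfl⟩ := h
    exact ofWord_mem_tangles (isTangle_cap_cup.2 ⟨ha, ha, rfl⟩)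
  | algebraMap r =>
    rw [Algebra.algebraMap_eq_smul_one]
    exact Submodule.smul_mem _ _ (one_mem_tangles n)
  | add a b _ _ ha hb => exact add_mem ha hb
  | mul a b _ _ ha hb => exact mul_mem_tangles ha hb

namespace TLRep

variable {R : Type} [Ring R] [Algebra K R] (T : TLRep R) (n : ℕ)

/-- The image of a slice with every strand replaced by `n` parallel strands. -/
def cabled (s : Slice) : R := T.word (cable n s)

/-- The Jones-Wenzl projector on the `j`-th band of `n` strands. -/
def band (j : ℕ) : R := T.eval (AnnularSkein.shift (n * j) (jonesWenzl n))

theorem cabled_cup (i : ℕ) : T.cabled n (cup i) = T.cups (n * i) n := by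
  simp only [cabled, word, cable, cup, cups, List.map_map]; rfl

theorem cabled_cap (i : ℕ) : T.cabled n (cap i) = T.caps (n * i) n := by
  simp only [cabled, word, cable, cap, caps, List.map_map, List.map_reverse]; rfl

theorem cabled_cross (e : Bool) (i : ℕ) : T.cabled n (cross e i) = T.grid e (n * i) n n := by
  simp only [cabled, word, cable, cross, grid, List.map_flatMap, List.map_map]; rfl

theorem cabled_far (g h : Piece) (i k : ℕ) :
    T.cabled n ⟨g, i⟩ * T.cabled n ⟨h, i + g.outputs + k⟩ =
      T.cabled n ⟨h, i + g.inputs + k⟩ * T.cabled n ⟨g, i⟩ := by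
  rw [cabled, cabled, cabled, cable_add n (i + g.outputs), cable_add n (i + g.inputs)]
  exact T.word_mul_word_shift (isTangle_cable n i g) _

theorem cabled_zigzag_left (i : ℕ) : T.cabled n (cup (i + 1)) * T.cabled n (cap i) = 1 := by
  rw [cabled_cup, cabled_cap, mul_add, mul_one, cups_mul_caps_left]

theorem cabled_zigzag_right (i : ℕ) : T.cabled n (cup i) * T.cabled n (cap (i + 1)) = 1 := by
  rw [cabled_cup, cabled_cap, mul_add, mul_one, cups_mul_caps_right]

theorem cabled_turn_cup (e : Bool) (i : ℕ) : T.cabled n (cup i) * T.cabled n (cross e (i + 1)) =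
    T.cabled n (cup (i + 1)) * T.cabled n (cross (!e) i) := by
  simp only [cabled_cup, cabled_cross, mul_add, mul_one, cups_mul_grid]

theorem cabled_turn_cap (e : Bool) (i : ℕ) : T.cabled n (cross e i) * T.cabled n (cap (i + 1)) =
    T.cabled n (cross (!e) (i + 1)) * T.cabled n (cap i) := by
  simp only [cabled_cap, cabled_cross, mul_add, mul_one, grid_mul_caps]

theorem cabled_type_II (e : Bool) (i : ℕ) :
    T.cabled n (cross e i) * T.cabled n (cross (!e) i) = 1 := by
  rw [cabled_cross, cabled_cross, grid_mul_grid]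

theorem cabled_type_III (e : Bool) (i : ℕ) :
    T.cabled n (cross e i) * T.cabled n (cross e (i + 1)) * T.cabled n (cross e i) =
      T.cabled n (cross e (i + 1)) * T.cabled n (cross e i) * T.cabled n (cross e (i + 1)) := by
  simp only [cabled_cross, mul_add, mul_one, grid_type_III]

/-! ### Projectors on bands -/

theorem band_eq_jw (j : ℕ) : T.band n j = (T.shift (n * j)).jw n := by
  rw [band, eval_shift, jw]

theorem band_mul_band (j : ℕ) : T.band n j * T.band n j = T.band n j := by
  rw [band_eq_jw, jw_mul_jw]

theorem band_mem (j : ℕ) :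
    AnnularSkein.shift (n * j) (jonesWenzl n) ∈ tangles (n * (j + 1)) (n * (j + 1)) :=
  shift_mem_tangles (jonesWenzl_mem_tangles n) (n * j)

theorem band_mul_shift {i j : ℕ} (h : j < i) (z : Formal) :
    T.band n j * T.eval (AnnularSkein.shift (n * i) z) =
      T.eval (AnnularSkein.shift (n * i) z) * T.band n j := by
  obtain ⟨k, rfl⟩ := Nat.exists_eq_add_of_le (Nat.succ_le_of_lt h)
  refine T.eval_mul_eval_shift ?_ z
  have := tangles_mono (band_mem n j) (n * k)
  rwa [← mul_add] at this

theorem commute_band (i j : ℕ) : Commute (T.band n i) (T.band n j) := by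
  rcases lt_trichotomy i j with h | rfl | h
  · exact T.band_mul_shift n h _
  · exact Commute.refl _
  · exact (T.band_mul_shift n h _).symm

theorem band_mul_cabled_of_lt {i j : ℕ} (h : j < i) (g : Piece) :
    T.band n j * T.cabled n ⟨g, i⟩ = T.cabled n ⟨g, i⟩ * T.band n j := by
  have := T.band_mul_shift n h (ofWord (cable n ⟨g, 0⟩))
  rwa [shift_ofWord, ← cable_add, eval_ofWord] at this

theorem band_mul_cabled_of_le (g : Piece) (i k : ℕ) :
    T.band n (i + g.inputs + k) * T.cabled n ⟨g, i⟩ =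
      T.cabled n ⟨g, i⟩ * T.band n (i + g.outputs + k) := by
  have := T.eval_mul_eval_shift (ofWord_mem_tangles (isTangle_cable n i g))
    (AnnularSkein.shift (n * k) (jonesWenzl n))
  rw [shift_shift, shift_shift, ← mul_add, ← mul_add, eval_ofWord] at this
  exact this.symm

/-- Whatever lets the generating hooks slide lets the projector slide, since it lies in the algebra
they generate. -/
theorem eval_shift_hooks_mul {y : Formal} (hy : y ∈ hooks n) {z : R} {N M : ℕ}
    (h : ∀ a, a + 1 < n → T.u (N + a) * z = z * T.u (M + a)) :
    T.eval (AnnularSkein.shift N y) * z = z * T.eval (AnnularSkein.shift M y) := by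
  induction hy using Algebra.adjoin_induction with
  | mem y hy =>
    obtain ⟨a, ha, rfl⟩ := hy
    simpa only [shift_ofWord, List.map_cons, List.map_nil, shift_cap, shift_cup, eval_hook]
      using h a ha
  | algebraMap r =>
    simp only [Algebra.algebraMap_eq_smul_one, shift_smul, map_smul, map_one, smul_mul_assoc,
      mul_smul_comm, one_mul, mul_one]
  | add a b _ _ ha hb => simp only [map_add, add_mul, mul_add, ha, hb]
  | mul a b _ _ ha hb => rw [map_mul, map_mul, mul_assoc, hb, ← mul_assoc, ha, map_mul, map_mul,
      mul_assoc]

theorem band_mul_cross_left (e : Bool) (i : ℕ) :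
    T.band n i * T.cabled n (cross e i) = T.cabled n (cross e i) * T.band n (i + 1) := by
  rw [cabled_cross, band, band, mul_add, mul_one]
  exact T.eval_shift_hooks_mul n (jonesWenzl_mem_hooks n) fun a ha => T.u_mul_grid_left ha

theorem band_mul_cross_right (e : Bool) (i : ℕ) :
    T.band n (i + 1) * T.cabled n (cross e i) = T.cabled n (cross e i) * T.band n i := by
  rw [cabled_cross, band, band, mul_add, mul_one]
  exact T.eval_shift_hooks_mul n (jonesWenzl_mem_hooks n) fun a ha => T.u_mul_grid ha

/-- The leading hook of each generator passes around the minima to the other band, commutes with the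
remaining factors on the first band, and is killed by the projector waiting there. -/
theorem cups_mul_hookIdeal {N M M' : ℕ} {y : Formal} (hy : y ∈ hookIdeal n)
    (h : ∀ a, a + 1 < n → T.cups N n * T.u (M + a) = T.cups N n * T.u (M' + (n - 2 - a)))
    (hc : ∀ y ∈ hooks n, ∀ a, a + 1 < n →
      T.u (M' + a) * T.eval (AnnularSkein.shift M y) =
        T.eval (AnnularSkein.shift M y) * T.u (M' + a)) :
    T.cups N n * T.eval (AnnularSkein.shift M y) *
      T.eval (AnnularSkein.shift M' (jonesWenzl n)) = 0 := by
  induction hy using Submodule.span_induction with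
  | mem y hy =>
    obtain ⟨a, ha, y, hy, rfl⟩ := hy
    have hk : T.u (M' + (n - 2 - a)) * T.eval (AnnularSkein.shift M' (jonesWenzl n)) = 0 := by
      rw [eval_shift, ← shift_u]
      exact (T.shift M').u_mul_jw (by omega)
    rw [map_mul, map_mul, shift_ofWord]
    simp only [List.map_cons, List.map_nil, shift_cap, shift_cup, eval_hook]
    rw [← mul_assoc, h a ha, mul_assoc (T.cups N n), hc y hy _ (by omega), mul_assoc, mul_assoc, hk,
      mul_zero, mul_zero]
  | zero => simp
  | add a b _ _ ha hb => simp only [map_add, mul_add, add_mul, ha, hb, add_zero]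
  | smul r a _ ha => simp only [shift_smul, map_smul, mul_smul_comm, smul_mul_assoc, ha, smul_zero]

theorem cup_mul_band_mul_band (i : ℕ) :
    T.cabled n (cup i) * T.band n i * T.band n (i + 1) = T.cabled n (cup i) * T.band n (i + 1) := by
  have h := T.cups_mul_hookIdeal (N := n * i) (M := n * i) (M' := n * i + n) n
    (jonesWenzl_sub_one_mem n) (fun a ha => T.cups_mul_u ha) fun y hy a ha => by
      have := T.eval_mul_eval_shift (shift_mem_tangles (hooks_le_tangles hy) (n * i))
        (ofWord [cap a, cup a])
      simpa only [shift_ofWord, List.map_cons, List.map_nil, shift_cap, shift_cup, eval_hook]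
        using this.symm
  rw [map_sub, map_sub, map_one, map_one, mul_sub, sub_mul, sub_eq_zero, mul_one] at h
  rw [cabled_cup, band, band, mul_add, mul_one]
  exact h

theorem cup_mul_band_mul_band' (i : ℕ) :
    T.cabled n (cup i) * T.band n i * T.band n (i + 1) = T.cabled n (cup i) * T.band n i := by
  have h := T.cups_mul_hookIdeal (N := n * i) (M := n * i + n) (M' := n * i) n
    (jonesWenzl_sub_one_mem n) (fun a ha => by
      have := T.cups_mul_u (N := n * i) (n := n) (a := n - 2 - a) (by omega)
      rw [this, show n - 2 - (n - 2 - a) = a by omega]) fun y hy a ha => by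
      have := T.eval_mul_eval_shift (shift_mem_tangles (ofWord_mem_tangles
        (isTangle_cap_cup.2 ⟨ha, ha, rfl⟩)) (n * i)) y
      simpa only [shift_ofWord, List.map_cons, List.map_nil, shift_cap, shift_cup, eval_hook]
        using this
  rw [map_sub, map_sub, map_one, map_one, mul_sub, sub_mul, sub_eq_zero, mul_one] at h
  rw [mul_assoc, (T.commute_band n i (i + 1)).eq, ← mul_assoc, cabled_cup, band, band, mul_add,
    mul_one]
  exact h

/-- A projector on either leg makes one on the other leg redundant, so both equal the version with
two projectors. No symmetry of `f⁽ⁿ⁾` under rotation is needed. -/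
theorem cup_mul_band (i : ℕ) :
    T.cabled n (cup i) * T.band n i = T.cabled n (cup i) * T.band n (i + 1) := by
  rw [← cup_mul_band_mul_band, cup_mul_band_mul_band']

theorem dual_band (j : ℕ) : T.dual.band n j = MulOpposite.op (T.band n j) := by
  rw [band_eq_jw, band_eq_jw, ← dual_jw]
  rfl

theorem dual_cabled_cup (i : ℕ) : T.dual.cabled n (cup i) = MulOpposite.op (T.cabled n (cap i)) := by
  rw [cabled_cup, cabled_cap, dual_cups]

theorem band_mul_cap (i : ℕ) :
    T.band n i * T.cabled n (cap i) = T.band n (i + 1) * T.cabled n (cap i) := by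
  have h := T.dual.cup_mul_band n i
  simp only [dual_band, dual_cabled_cup, ← MulOpposite.op_mul] at h
  exact MulOpposite.op_injective h

/-! ### Products of projectors -/

/-- The product of the projectors on a set of bands. -/
def bands (J : Finset ℕ) : R := J.noncommProd (T.band n) fun i _ j _ _ => T.commute_band n i j

@[simp] theorem bands_empty : T.bands n ∅ = 1 := Finset.noncommProd_empty _ _

theorem bands_insert_of_notMem {j : ℕ} {J : Finset ℕ} (h : j ∉ J) :
    T.bands n (insert j J) = T.band n j * T.bands n J :=
  Finset.noncommProd_insert_of_notMem _ _ _ _ h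

/-- By idempotence this holds for `j ∈ J` as well, so products of projectors follow unions of sets.
-/
theorem bands_insert (j : ℕ) (J : Finset ℕ) : T.bands n (insert j J) = T.band n j * T.bands n J := by
  by_cases h : j ∈ J
  · rw [Finset.insert_eq_of_mem h]
    conv_rhs => rw [← Finset.insert_erase h]
    conv_lhs => rw [← Finset.insert_erase h]
    rw [bands_insert_of_notMem _ _ (Finset.notMem_erase j J), ← mul_assoc, band_mul_band]
  · exact T.bands_insert_of_notMem n h

theorem bands_mul_bands (J L : Finset ℕ) : T.bands n J * T.bands n L = T.bands n (J ∪ L) := by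
  induction J using Finset.induction_on with
  | empty => simp
  | insert j J _ ih => rw [bands_insert, mul_assoc, ih, Finset.insert_union, bands_insert]

theorem bands_mul_of_band_mul {J : Finset ℕ} {y : R} {σ : ℕ → ℕ}
    (h : ∀ j ∈ J, T.band n j * y = y * T.band n (σ j)) :
    T.bands n J * y = y * T.bands n (J.image σ) := by
  induction J using Finset.induction_on with
  | empty => simp
  | insert j J _ ih =>
    rw [bands_insert, mul_assoc, ih fun j hj => h j (Finset.mem_insert_of_mem hj), ← mul_assoc,
      h j (Finset.mem_insert_self j J), mul_assoc, Finset.image_insert, bands_insert]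

theorem mul_bands_of_mul_band {J : Finset ℕ} {y : R} {σ : ℕ → ℕ}
    (h : ∀ j ∈ J, y * T.band n j = T.band n (σ j) * y) :
    y * T.bands n J = T.bands n (J.image σ) * y := by
  induction J using Finset.induction_on with
  | empty => simp
  | insert j J _ ih =>
    rw [bands_insert, ← mul_assoc, h j (Finset.mem_insert_self j J), mul_assoc,
      ih fun j hj => h j (Finset.mem_insert_of_mem hj), Finset.image_insert, bands_insert,
      mul_assoc]

theorem commute_bands (J L : Finset ℕ) : Commute (T.bands n J) (T.bands n L) := by
  rw [Commute, SemiconjBy, bands_mul_bands, bands_mul_bands, Finset.union_comm]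

theorem eval_projectorRow (p : ℕ) : T.eval (projectorRow n p) = T.bands n (Finset.range p) := by
  induction p with
  | zero => simp [projectorRow]
  | succ p ih =>
    have h1 : projectorRow n (p + 1) = projectorRow n p * AnnularSkein.shift (n * p) (jonesWenzl n) := by
      simp [projectorRow, List.range_succ]
    have h2 : T.band n p = T.bands n {p} := by
      rw [← insert_empty_eq, bands_insert, bands_empty, mul_one]
    rw [h1, map_mul, ih, Finset.range_add_one, bands_insert,
      show T.eval (AnnularSkein.shift (n * p) (jonesWenzl n)) = T.band n p from rfl, h2]
    exact T.commute_bands n _ _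

end TLRep

/-- The number of a band after the insertion of two bands at position `i`. -/
def skipTwo (i j : ℕ) : ℕ := if j < i then j else j + 2

namespace TLRep

variable {R : Type} [Ring R] [Algebra K R] (T : TLRep R) (n : ℕ)

theorem bands_mul_cup (J : Finset ℕ) (i : ℕ) :
    T.bands n J * T.cabled n (cup i) = T.cabled n (cup i) * T.bands n (J.image (skipTwo i)) := by
  refine T.bands_mul_of_band_mul n fun j _ => ?_
  rw [skipTwo]
  split_ifs with h
  · exact T.band_mul_cabled_of_lt n h .cup
  · obtain ⟨k, rfl⟩ := Nat.exists_eq_add_of_le (Nat.not_lt.1 h)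
    rw [show i + k + 2 = i + 2 + k by omega]
    exact T.band_mul_cabled_of_le n .cup i k

theorem cap_mul_bands (J : Finset ℕ) (i : ℕ) :
    T.cabled n (cap i) * T.bands n J = T.bands n (J.image (skipTwo i)) * T.cabled n (cap i) := by
  refine T.mul_bands_of_mul_band n fun j _ => ?_
  rw [skipTwo]
  split_ifs with h
  · exact (T.band_mul_cabled_of_lt n h .cap).symm
  · obtain ⟨k, rfl⟩ := Nat.exists_eq_add_of_le (Nat.not_lt.1 h)
    rw [show i + k + 2 = i + 2 + k by omega]
    exact (T.band_mul_cabled_of_le n .cap i k).symm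

theorem bands_mul_cross (J : Finset ℕ) (e : Bool) (i : ℕ) :
    T.bands n J * T.cabled n (cross e i) =
      T.cabled n (cross e i) * T.bands n (J.image (Equiv.swap i (i + 1))) := by
  refine T.bands_mul_of_band_mul n fun j _ => ?_
  rcases lt_trichotomy j i with h | rfl | h
  · rw [Equiv.swap_apply_of_ne_of_ne (by omega) (by omega)]
    exact T.band_mul_cabled_of_lt n h (.crossing e)
  · rw [Equiv.swap_apply_left, band_mul_cross_left]
  · rcases eq_or_lt_of_le (Nat.succ_le_of_lt h) with rfl | h
    · rw [Nat.succ_eq_add_one, Equiv.swap_apply_right, band_mul_cross_right]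
    · rw [Equiv.swap_apply_of_ne_of_ne (by omega) (by omega)]
      obtain ⟨k, rfl⟩ := Nat.exists_eq_add_of_le (show i + 2 ≤ j from h)
      exact T.band_mul_cabled_of_le n (.crossing e) i k

theorem cup_mul_bands {i : ℕ} {J : Finset ℕ} (h : i ∈ J ∨ i + 1 ∈ J) :
    T.cabled n (cup i) * T.bands n J =
      T.cabled n (cup i) * T.bands n (insert i (insert (i + 1) J)) := by
  rw [bands_insert, bands_insert, ← mul_assoc, ← mul_assoc]
  rcases h with h | h
  · rw [cup_mul_band_mul_band', mul_assoc, ← bands_insert, Finset.insert_eq_of_mem h]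
  · rw [cup_mul_band_mul_band, mul_assoc, ← bands_insert, Finset.insert_eq_of_mem h]

/-- The image of the coloured version of a tangle. -/
def colored (p : ℕ) (w : List Slice) : R := T.eval (coloredTangle n p w)

theorem colored_nil (p : ℕ) : T.colored n p [] = T.bands n (Finset.range p) :=
  T.eval_projectorRow n p

theorem colored_cons (p : ℕ) (s : Slice) (w : List Slice) : T.colored n p (s :: w) =
    T.bands n (Finset.range p) * T.cabled n s *
      T.colored n (p - s.piece.inputs + s.piece.outputs) w := by
  simp only [colored, coloredTangle, map_mul, eval_projectorRow, eval_ofWord, cabled]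

theorem bands_mul_self (J : Finset ℕ) : T.bands n J * T.bands n J = T.bands n J := by
  rw [bands_mul_bands, Finset.union_self]

theorem bands_mul_colored (p : ℕ) (w : List Slice) :
    T.bands n (Finset.range p) * T.colored n p w = T.colored n p w := by
  cases w with
  | nil => rw [colored_nil, bands_mul_self]
  | cons s w => rw [colored_cons, ← mul_assoc, ← mul_assoc, bands_mul_self]

theorem colored_append {p q : ℕ} {v : List Slice} (h : IsTangle p v q) (w : List Slice) :
    T.colored n p (v ++ w) = T.colored n p v * T.colored n q w := by
  induction v generalizing p with
  | nil => obtain rfl : p = q := h; rw [colored_nil, bands_mul_colored, List.nil_append]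
  | cons s v ih => rw [List.cons_append, colored_cons, ih h.2, colored_cons]; simp only [mul_assoc]

theorem bands_mul_cup_mul_bands (p i : ℕ) :
    T.bands n (Finset.range p) * T.cabled n (cup i) * T.bands n (Finset.range (p + 2)) =
      T.cabled n (cup i) * T.bands n (Finset.range (p + 2)) := by
  rw [bands_mul_cup, mul_assoc, bands_mul_bands, Finset.union_eq_right.2]
  intro j hj
  simp only [Finset.mem_image, Finset.mem_range, skipTwo] at *
  obtain ⟨a, ha, rfl⟩ := hj
  split_ifs <;> omega

theorem bands_mul_cap_mul_bands (p i : ℕ) :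
    T.bands n (Finset.range (p + 2)) * T.cabled n (cap i) * T.bands n (Finset.range p) =
      T.bands n (Finset.range (p + 2)) * T.cabled n (cap i) := by
  rw [mul_assoc, cap_mul_bands, ← mul_assoc, bands_mul_bands, Finset.union_eq_left.2]
  intro j hj
  simp only [Finset.mem_image, Finset.mem_range, skipTwo] at *
  obtain ⟨a, ha, rfl⟩ := hj
  split_ifs <;> omega

theorem image_swap_range {p i : ℕ} (h : i + 2 ≤ p) :
    (Finset.range p).image (Equiv.swap i (i + 1)) = Finset.range p := by
  ext j
  simp only [Finset.mem_image, Finset.mem_range]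
  constructor
  · rintro ⟨a, ha, rfl⟩
    rw [Equiv.swap_apply_def]
    split_ifs <;> omega
  · intro hj
    refine ⟨Equiv.swap i (i + 1) j, ?_, Equiv.swap_apply_self _ _ _⟩
    rw [Equiv.swap_apply_def]
    split_ifs <;> omega

theorem bands_range_mul_cross {p i : ℕ} (h : i + 2 ≤ p) (e : Bool) :
    T.bands n (Finset.range p) * T.cabled n (cross e i) =
      T.cabled n (cross e i) * T.bands n (Finset.range p) := by
  rw [bands_mul_cross, image_swap_range h]

/-- Pushed inwards, the outer rows cover every middle band outside `{i, i + 1} ∩ {j, j + 1}`. As `i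
≠ j`, at least one leg of the minimum is covered, and `cup_mul_bands` supplies the other. For `i =
j` the two slices form a circle that no outer projector reaches. -/
theorem cup_mul_bands_mul_cap {p i j : ℕ} (hi : i ≤ p) (hj : j ≤ p) (h : i ≠ j) :
    T.cabled n (cup i) * T.bands n (Finset.range (p + 2)) * T.cabled n (cap j) =
      T.bands n (Finset.range p) * (T.cabled n (cup i) * T.cabled n (cap j)) *
        T.bands n (Finset.range p) := by
  have hmem : ∀ i p a, a ∈ (Finset.range p).image (skipTwo i) ↔
      a < i ∧ a < p ∨ i + 2 ≤ a ∧ a < p + 2 := by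
    intro i p a
    simp only [Finset.mem_image, Finset.mem_range, skipTwo]
    constructor
    · rintro ⟨b, hb, rfl⟩
      split_ifs <;> omega
    · rintro (⟨h1, h2⟩ | ⟨h1, h2⟩)
      · exact ⟨a, h2, if_pos h1⟩
      · exact ⟨a - 2, by omega, by rw [if_neg (by omega)]; omega⟩
  have hJ : insert i (insert (i + 1) ((Finset.range p).image (skipTwo i) ∪
      (Finset.range p).image (skipTwo j))) = Finset.range (p + 2) := by
    ext a
    simp only [Finset.mem_insert, Finset.mem_union, hmem, Finset.mem_range]
    omega
  symm
  calc _ = T.bands n (Finset.range p) * T.cabled n (cup i) *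
        (T.cabled n (cap j) * T.bands n (Finset.range p)) := by simp only [mul_assoc]
    _ = T.cabled n (cup i) * T.bands n ((Finset.range p).image (skipTwo i) ∪
        (Finset.range p).image (skipTwo j)) * T.cabled n (cap j) := by
      rw [bands_mul_cup, cap_mul_bands, ← bands_mul_bands]; simp only [mul_assoc]
    _ = _ := by
      rw [cup_mul_bands, hJ]
      simp only [Finset.mem_union, hmem]
      omega

/-- The projectors between two slices may be omitted, unless the slices form a circle. -/
theorem colored_pair {p : ℕ} {s t : Slice} (hs : s.pos + s.piece.inputs ≤ p)
    (ht : t.pos + t.piece.inputs ≤ p - s.piece.inputs + s.piece.outputs)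
    (h : ∀ i, ¬(s = cup i ∧ t = cap i)) :
    T.colored n p [s, t] = T.bands n (Finset.range p) * (T.cabled n s * T.cabled n t) *
      T.bands n (Finset.range (p - s.piece.inputs + s.piece.outputs -
        t.piece.inputs + t.piece.outputs)) := by
  rw [colored_cons, colored_cons, colored_nil]
  generalize hq : p - s.piece.inputs + s.piece.outputs = q at *
  generalize hr : q - t.piece.inputs + t.piece.outputs = r at *
  have left : T.bands n (Finset.range p) * T.cabled n s * T.bands n (Finset.range q) =
      T.bands n (Finset.range p) * T.cabled n s → T.bands n (Finset.range p) * T.cabled n s *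
        (T.bands n (Finset.range q) * T.cabled n t * T.bands n (Finset.range r)) =
      T.bands n (Finset.range p) * (T.cabled n s * T.cabled n t) * T.bands n (Finset.range r) := by
    intro h
    rw [← mul_assoc, ← mul_assoc, h]
    simp only [mul_assoc]
  have right : T.bands n (Finset.range q) * T.cabled n t * T.bands n (Finset.range r) =
      T.cabled n t * T.bands n (Finset.range r) → T.bands n (Finset.range p) * T.cabled n s *
        (T.bands n (Finset.range q) * T.cabled n t * T.bands n (Finset.range r)) =
      T.bands n (Finset.range p) * (T.cabled n s * T.cabled n t) * T.bands n (Finset.range r) := by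
    intro h
    rw [h]
    simp only [mul_assoc]
  rcases s with ⟨_ | _ | e, i⟩
  · rcases t with ⟨_ | _ | e', j⟩ <;>
      simp only [Piece.inputs, Piece.outputs, Nat.sub_zero, add_zero] at *
    · subst hq hr
      exact right (T.bands_mul_cup_mul_bands n _ j)
    · subst hq
      obtain rfl : p = r := by omega
      have hij : i ≠ j := by
        rintro rfl
        exact h i ⟨rfl, rfl⟩
      have h1 := T.cup_mul_bands_mul_cap n (show i ≤ p by omega) (show j ≤ p by omega) hij
      have h2 := T.bands_mul_cap_mul_bands n p j
      have h3 := T.bands_mul_cup_mul_bands n p i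
      simp only [cup, cap] at h1 h2 h3
      rw [h2, ← mul_assoc, h3, h1]
    · obtain rfl : q = r := by omega
      refine right ?_
      have := T.bands_range_mul_cross n (p := q) (i := j) (by omega) e'
      simp only [cross] at this
      rw [this, mul_assoc, bands_mul_self]
  · simp only [Piece.inputs, Piece.outputs, add_zero] at hs hq
    obtain rfl : p = q + 2 := by omega
    exact left (T.bands_mul_cap_mul_bands n q i)
  · simp only [Piece.inputs, Piece.outputs] at hs hq
    obtain rfl : p = q := by omega
    refine left ?_
    have := T.bands_range_mul_cross n (p := p) (i := i) (by omega) e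
    simp only [cross] at this
    rw [this, mul_assoc, bands_mul_self]

/-! ### Curls -/

/-- A band with a curl on its right. -/
def curlRight (e : Bool) (i : ℕ) : R :=
  T.cabled n (cup (i + 1)) * T.cabled n (cross e i) * T.cabled n (cap (i + 1))

/-- A band with a curl on its left. -/
def curlLeft (e : Bool) (i : ℕ) : R :=
  T.cabled n (cup i) * T.cabled n (cross e (i + 1)) * T.cabled n (cap i)

/-- The projector travels once along the curl: through the crossing, over the maximum, down past the
crossing, around the minimum, and through the crossing again. -/
theorem band_mul_curlRight (e : Bool) (i : ℕ) :
    T.band n i * T.curlRight n e i = T.curlRight n e i * T.band n i := by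
  have h1 : T.band n i * T.cabled n (cup (i + 1)) = T.cabled n (cup (i + 1)) * T.band n i :=
    T.band_mul_cabled_of_lt n (Nat.lt_succ_self i) .cup
  have h2 : T.band n (i + 2) * T.cabled n (cross e i) =
      T.cabled n (cross e i) * T.band n (i + 2) := T.band_mul_cabled_of_le n (.crossing e) i 0
  have h3 : T.band n i * T.cabled n (cap (i + 1)) = T.cabled n (cap (i + 1)) * T.band n i :=
    T.band_mul_cabled_of_lt n (Nat.lt_succ_self i) .cap
  calc T.band n i * T.curlRight n e i
      = T.cabled n (cup (i + 1)) * (T.band n i * T.cabled n (cross e i)) *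
          T.cabled n (cap (i + 1)) := by
        rw [curlRight, ← mul_assoc, ← mul_assoc, h1]; simp only [mul_assoc]
    _ = T.cabled n (cup (i + 1)) * T.cabled n (cross e i) *
          (T.band n (i + 1) * T.cabled n (cap (i + 1))) := by
        rw [band_mul_cross_left]; simp only [mul_assoc]
    _ = T.cabled n (cup (i + 1)) * (T.cabled n (cross e i) * T.band n (i + 2)) *
          T.cabled n (cap (i + 1)) := by rw [band_mul_cap]; simp only [mul_assoc]
    _ = T.cabled n (cup (i + 1)) * T.band n (i + 1) * T.cabled n (cross e i) *
          T.cabled n (cap (i + 1)) := by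
        rw [← h2, cup_mul_band]; simp only [mul_assoc]
    _ = T.curlRight n e i * T.band n i := by
        rw [mul_assoc _ (T.band n (i + 1)), band_mul_cross_right, curlRight,
          mul_assoc _ _ (T.band n i), ← h3]
        simp only [mul_assoc]

theorem band_mul_curlLeft (e : Bool) (i : ℕ) :
    T.band n i * T.curlLeft n e i = T.curlLeft n e i * T.band n i := by
  have h1 : T.band n i * T.cabled n (cup i) = T.cabled n (cup i) * T.band n (i + 2) :=
    T.band_mul_cabled_of_le n .cup i 0
  have h2 : T.band n i * T.cabled n (cross e (i + 1)) =
      T.cabled n (cross e (i + 1)) * T.band n i :=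
    T.band_mul_cabled_of_lt n (Nat.lt_succ_self i) (.crossing e)
  have h3 : T.band n (i + 2) * T.cabled n (cap i) = T.cabled n (cap i) * T.band n i :=
    T.band_mul_cabled_of_le n .cap i 0
  have h4 := T.band_mul_cross_right n e (i + 1)
  have h5 := T.band_mul_cross_left n e (i + 1)
  calc T.band n i * T.curlLeft n e i
      = T.cabled n (cup i) * (T.band n (i + 1 + 1) * T.cabled n (cross e (i + 1))) *
          T.cabled n (cap i) := by
        rw [curlLeft, ← mul_assoc, ← mul_assoc, h1]; simp only [mul_assoc]
    _ = T.cabled n (cup i) * T.cabled n (cross e (i + 1)) *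
          (T.band n (i + 1) * T.cabled n (cap i)) := by
        rw [h4]; simp only [mul_assoc]
    _ = T.cabled n (cup i) * (T.cabled n (cross e (i + 1)) * T.band n i) *
          T.cabled n (cap i) := by rw [← band_mul_cap]; simp only [mul_assoc]
    _ = T.cabled n (cup i) * T.band n i * T.cabled n (cross e (i + 1)) *
          T.cabled n (cap i) := by
        rw [← h2]; simp only [mul_assoc]
    _ = T.cabled n (cup i) * (T.band n (i + 1) * T.cabled n (cross e (i + 1))) *
          T.cabled n (cap i) := by
        rw [cup_mul_band]; simp only [mul_assoc]
    _ = T.curlLeft n e i * T.band n i := by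
        rw [h5, curlLeft, mul_assoc _ _ (T.band n i), ← h3]
        simp only [mul_assoc]

/-- A right curl on the right leg of a minimum untwists into a crossing of the two legs.
`cup_mul_curlLeft` gives the same crossing from a left curl on the left leg, so the two curls can be
compared. -/
theorem cup_mul_curlRight (e : Bool) (i : ℕ) : T.cabled n (cup i) * T.curlRight n e (i + 1) =
    T.cabled n (cup i) * T.cabled n (cross (!e) i) := by
  have h1 : T.cabled n (cup i) * T.cabled n (cup (i + 2)) =
      T.cabled n (cup i) * T.cabled n (cup i) := T.cabled_far n .cup .cup i 0
  have h2 : T.cabled n (cross (!e) i) * T.cabled n (cap (i + 2)) =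
      T.cabled n (cap (i + 2)) * T.cabled n (cross (!e) i) :=
    T.cabled_far n (.crossing !e) .cap i 0
  calc T.cabled n (cup i) * T.curlRight n e (i + 1)
      = T.cabled n (cup i) * (T.cabled n (cup i) * T.cabled n (cross e (i + 1))) *
          T.cabled n (cap (i + 2)) := by
        rw [curlRight, ← mul_assoc, ← mul_assoc, h1]; simp only [mul_assoc]
    _ = T.cabled n (cup i) * (T.cabled n (cup (i + 1)) * T.cabled n (cap (i + 1 + 1))) *
          T.cabled n (cross (!e) i) := by
        rw [cabled_turn_cup, mul_assoc, mul_assoc, h2]; simp only [mul_assoc]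
    _ = _ := by rw [cabled_zigzag_right, mul_one]

theorem cup_mul_curlLeft (e : Bool) (i : ℕ) : T.cabled n (cup i) * T.curlLeft n e i =
    T.cabled n (cup i) * T.cabled n (cross (!e) i) := by
  have h1 : T.cabled n (cup i) * T.cabled n (cup (i + 2)) =
      T.cabled n (cup i) * T.cabled n (cup i) := T.cabled_far n .cup .cup i 0
  have h2 : T.cabled n (cross (!e) i) * T.cabled n (cup (i + 2)) =
      T.cabled n (cup (i + 2)) * T.cabled n (cross (!e) i) :=
    T.cabled_far n (.crossing !e) .cup i 0
  have h3 := T.cabled_turn_cap n (!e) i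
  rw [Bool.not_not] at h3
  calc T.cabled n (cup i) * T.curlLeft n e i
      = T.cabled n (cup i) * T.cabled n (cup i) *
          (T.cabled n (cross e (i + 1)) * T.cabled n (cap i)) := by
        rw [curlLeft]; simp only [mul_assoc]
    _ = T.cabled n (cup i) * (T.cabled n (cup (i + 2)) * T.cabled n (cross (!e) i)) *
          T.cabled n (cap (i + 1)) := by
        rw [← h3, ← h1]; simp only [mul_assoc]
    _ = T.cabled n (cup i) * T.cabled n (cross (!e) i) *
          (T.cabled n (cup (i + 1 + 1)) * T.cabled n (cap (i + 1))) := by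
        rw [← h2]; simp only [mul_assoc]
    _ = _ := by rw [cabled_zigzag_left, mul_one]

end TLRep

theorem isTangle_cabled_curl {p i j k : ℕ} (n : ℕ) (e : Bool) (hi : i ≤ p) (hj : j ≤ p)
    (hk : k ≤ p) :
    IsTangle (n * p) (cable n (cup i) ++ cable n (cross e j) ++ cable n (cap k)) (n * p) := by
  refine ((isTangle_cable_slice (s := cup i) hi).append
    (isTangle_cable_slice (s := cross e j) ?_)).append (isTangle_cable_slice (s := cap k) ?_)
  all_goals simp only [cup, cross, cap, Piece.inputs, Piece.outputs]; omega

/-- The curls on a coloured band can be removed at the cost of a scalar. -/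
theorem exists_curl_scalars (n : ℕ) (e : Bool) : ∃ r s : K,
    ∀ (R : Type) [Ring R] [Algebra K R] (T : TLRep R) (i : ℕ),
      T.band n i * T.curlRight n e i = r • T.band n i ∧
      T.band n i * T.curlLeft n e i = s • T.band n i := by
  have hsh : ∀ (R : Type) [Ring R] [Algebra K R] (T : TLRep R) (i k : ℕ) (g : Piece),
      (T.shift (n * i)).word (cable n ⟨g, k⟩) = T.cabled n ⟨g, i + k⟩ := by
    intro R _ _ T i k g
    rw [TLRep.cabled, cable_add, TLRep.word_shift]
  have h1 := ofWord_mem_tangles (isTangle_cabled_curl (p := 1) n e (i := 1) (j := 0) (k := 1)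
    le_rfl zero_le_one le_rfl)
  have h2 := ofWord_mem_tangles (isTangle_cabled_curl (p := 1) n e (i := 0) (j := 1) (k := 0)
    zero_le_one le_rfl zero_le_one)
  rw [mul_one] at h1 h2
  obtain ⟨r, hr⟩ := TLRep.exists_jw_mul_eval_mul_jw h1
  obtain ⟨s, hs⟩ := TLRep.exists_jw_mul_eval_mul_jw h2
  refine ⟨r, s, fun R _ _ T i => ⟨?_, ?_⟩⟩
  · have := hr R (T.shift (n * i))
    rw [← TLRep.band_eq_jw, TLRep.eval_ofWord, TLRep.word_append, TLRep.word_append, cup, cross, cap,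
      hsh, hsh, hsh] at this
    rw [← this, mul_assoc]
    change _ = T.band n i * (T.curlRight n e i * T.band n i)
    rw [← TLRep.band_mul_curlRight, ← mul_assoc, TLRep.band_mul_band]
  · have := hs R (T.shift (n * i))
    rw [← TLRep.band_eq_jw, TLRep.eval_ofWord, TLRep.word_append, TLRep.word_append, cup, cross, cap,
      hsh, hsh, hsh] at this
    rw [← this, mul_assoc]
    change _ = T.band n i * (T.curlLeft n e i * T.band n i)
    rw [← TLRep.band_mul_curlLeft, ← mul_assoc, TLRep.band_mul_band]

/-- Adding a maximum straightens the minimum and leaves the projector alone. -/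
theorem cup_mul_band_ne_zero (n : ℕ) :
    spinRep.cabled n (cup 0) * spinRep.band n 0 ≠ 0 := by
  intro h
  have h1 : spinRep.band n 0 * spinRep.cabled n (cap 1) =
      spinRep.cabled n (cap 1) * spinRep.band n 0 :=
    spinRep.band_mul_cabled_of_lt n Nat.zero_lt_one .cap
  have h2 := congrArg (· * spinRep.cabled n (cap 1)) h
  simp only [mul_assoc, h1, zero_mul] at h2
  rw [← mul_assoc, show (1 : ℕ) = 0 + 1 from rfl, TLRep.cabled_zigzag_right, one_mul,
    TLRep.band_eq_jw] at h2
  exact spinRep_shift_jw_ne_zero n _ h2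

theorem eq_of_smul_eq_smul_of_ne_zero {F V : Type} [Field F] [AddCommGroup V] [Module F V]
    {r s : F} {v : V} (hv : v ≠ 0) (h : r • v = s • v) : r = s :=
  smul_left_injective F hv h

/-- On a coloured minimum in `spinRep` both curls act as the same crossing, so their scalars agree.
They are nonzero because the crossing is invertible and the coloured minimum is not zero. -/
theorem exists_curl_scalar (n : ℕ) (e : Bool) : ∃ r : K, r ≠ 0 ∧
    ∀ (R : Type) [Ring R] [Algebra K R] (T : TLRep R) (i : ℕ),
      T.band n i * T.curlRight n e i = r • T.band n i ∧
      T.band n i * T.curlLeft n e i = r • T.band n i := by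
  have key : ∀ (e : Bool) (r s : K), (∀ (R : Type) [Ring R] [Algebra K R] (T : TLRep R) (i : ℕ),
      T.band n i * T.curlRight n e i = r • T.band n i ∧
      T.band n i * T.curlLeft n e i = s • T.band n i) →
      spinRep.cabled n (cup 0) * spinRep.band n 0 * spinRep.cabled n (cross (!e) 0) =
        r • (spinRep.cabled n (cup 0) * spinRep.band n 0) ∧
      spinRep.cabled n (cup 0) * spinRep.band n 0 * spinRep.cabled n (cross (!e) 0) =
        s • (spinRep.cabled n (cup 0) * spinRep.band n 0) := by
    intro e r s h
    -- For the minimum at `0`, the right curl sits on its right leg, band `1`, and the left curl on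
    -- its left leg, band `0`.
    obtain ⟨h1, -⟩ := h _ spinRep 1
    obtain ⟨-, h2⟩ := h _ spinRep 0
    have hr := spinRep.cup_mul_curlRight n e 0
    have hl := spinRep.cup_mul_curlLeft n e 0
    have hc := spinRep.cup_mul_band n 0
    have hx := spinRep.band_mul_cross_left n (!e) 0
    have hx' := spinRep.band_mul_cross_right n (!e) 0
    simp only [zero_add] at hr hc hx hx'
    constructor
    · rw [mul_assoc, hx, ← mul_assoc, ← hr, mul_assoc, ← TLRep.band_mul_curlRight, h1,
        mul_smul_comm, hc]
    · rw [hc, mul_assoc, hx', ← mul_assoc, ← hl, mul_assoc, ← TLRep.band_mul_curlLeft, h2,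
        mul_smul_comm, hc]
  obtain ⟨r, s, h⟩ := exists_curl_scalars n e
  obtain ⟨r', s', h'⟩ := exists_curl_scalars n (!e)
  obtain ⟨k1, k2⟩ := key e r s h
  obtain ⟨k3, -⟩ := key (!e) r' s' h'
  have hne := cup_mul_band_ne_zero n
  obtain rfl : r = s :=
    eq_of_smul_eq_smul_of_ne_zero (V := (Module.End K Spins)ᵐᵒᵖ) hne (k1.symm.trans k2)
  refine ⟨r, ?_, h⟩
  rintro rfl
  rw [zero_smul] at k1
  have h2 := spinRep.cabled_type_II n (!e) 0
  have h3 := congrArg (· * spinRep.cabled n (cross (!!e) 0)) k1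
  simp only [mul_assoc, h2, mul_one, zero_mul] at h3
  exact hne h3

/-- The factor by which a curl changes a coloured tangle. -/
def curlScalar (n : ℕ) (e : Bool) : K := (exists_curl_scalar n e).choose

theorem curlScalar_ne_zero (n : ℕ) (e : Bool) : curlScalar n e ≠ 0 :=
  (exists_curl_scalar n e).choose_spec.1

namespace TLRep

variable {R : Type} [Ring R] [Algebra K R] (T : TLRep R) (n : ℕ)

theorem band_mul_curlRight_eq (e : Bool) (i : ℕ) :
    T.band n i * T.curlRight n e i = curlScalar n e • T.band n i :=
  ((exists_curl_scalar n e).choose_spec.2 R T i).1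

theorem band_mul_curlLeft_eq (e : Bool) (i : ℕ) :
    T.band n i * T.curlLeft n e i = curlScalar n e • T.band n i :=
  ((exists_curl_scalar n e).choose_spec.2 R T i).2

theorem bands_mul_band {p i : ℕ} (h : i < p) :
    T.bands n (Finset.range p) * T.band n i = T.bands n (Finset.range p) := by
  have h1 : T.band n i = T.bands n {i} := by
    rw [← insert_empty_eq, bands_insert, bands_empty, mul_one]
  rw [h1, bands_mul_bands, Finset.union_eq_left.2]
  simpa using h

/-- The outer rows pushed inwards miss only the two legs of the minimum. The crossing exchanges one
of these with a neighbouring band, so the row coming from above covers that leg, and `cup_mul_bands`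
supplies the other. -/
theorem colored_curl {p i j : ℕ} (e : Bool) (hi : i ≤ p) (hj : j ≤ p)
    (hij : i = j + 1 ∨ j = i + 1) :
    T.colored n p [cup i, cross e j, cap i] = T.bands n (Finset.range p) *
      (T.cabled n (cup i) * T.cabled n (cross e j) * T.cabled n (cap i)) *
        T.bands n (Finset.range p) := by
  have hmem : ∀ i p a, a ∈ (Finset.range p).image (skipTwo i) ↔
      a < i ∧ a < p ∨ i + 2 ≤ a ∧ a < p + 2 := by
    intro i p a
    simp only [Finset.mem_image, Finset.mem_range, skipTwo]
    constructor
    · rintro ⟨b, hb, rfl⟩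
      split_ifs <;> omega
    · rintro (⟨h1, h2⟩ | ⟨h1, h2⟩)
      · exact ⟨a, h2, if_pos h1⟩
      · exact ⟨a - 2, by omega, by rw [if_neg (by omega)]; omega⟩
  have hsw : ∀ (J : Finset ℕ) a, a ∈ J.image (Equiv.swap j (j + 1)) ↔
      Equiv.swap j (j + 1) a ∈ J := by
    intro J a
    simp only [Finset.mem_image]
    constructor
    · rintro ⟨b, hb, rfl⟩
      rwa [Equiv.swap_apply_self]
    · exact fun h => ⟨_, h, Equiv.swap_apply_self _ _ _⟩
  have hJ : insert i (insert (i + 1) ((Finset.range p).image (skipTwo i) ∪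
      ((Finset.range p).image (skipTwo i)).image (Equiv.swap j (j + 1)))) =
        Finset.range (p + 2) := by
    ext a
    simp only [Finset.mem_insert, Finset.mem_union, hsw, hmem, Finset.mem_range,
      Equiv.swap_apply_def]
    split_ifs <;> omega
  have hx : ∀ J, T.cabled n (cross e j) * T.bands n J =
      T.bands n (J.image (Equiv.swap j (j + 1))) * T.cabled n (cross e j) := by
    intro J
    rw [bands_mul_cross, Finset.image_image]
    congr 2
    simp [Function.comp_def]
  have hX := T.bands_range_mul_cross n (p := p + 2) (i := j) (by omega) e
  rw [colored_cons, colored_cons, colored_cons, colored_nil]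
  change T.bands n (Finset.range p) * T.cabled n (cup i) * (T.bands n (Finset.range (p + 2)) *
    T.cabled n (cross e j) * (T.bands n (Finset.range (p + 2)) * T.cabled n (cap i) *
      T.bands n (Finset.range p))) = _
  have e1 : T.bands n (Finset.range p) *
      (T.cabled n (cup i) * T.cabled n (cross e j) * T.cabled n (cap i)) *
        T.bands n (Finset.range p) = T.cabled n (cup i) * T.bands n (Finset.range (p + 2)) *
          T.cabled n (cross e j) * T.cabled n (cap i) := by
    calc _ = T.bands n (Finset.range p) * T.cabled n (cup i) * T.cabled n (cross e j) *
          (T.cabled n (cap i) * T.bands n (Finset.range p)) := by simp only [mul_assoc]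
      _ = T.cabled n (cup i) * (T.bands n ((Finset.range p).image (skipTwo i)) *
          (T.cabled n (cross e j) * T.bands n ((Finset.range p).image (skipTwo i)))) *
            T.cabled n (cap i) := by
          rw [bands_mul_cup, cap_mul_bands]; simp only [mul_assoc]
      _ = T.cabled n (cup i) * T.bands n ((Finset.range p).image (skipTwo i) ∪
          ((Finset.range p).image (skipTwo i)).image (Equiv.swap j (j + 1))) *
            T.cabled n (cross e j) * T.cabled n (cap i) := by
          rw [hx, ← bands_mul_bands]; simp only [mul_assoc]
      _ = _ := by
          rw [cup_mul_bands, hJ]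
          simp only [Finset.mem_union, hsw, hmem, Equiv.swap_apply_def]
          split_ifs <;> omega
  rw [e1, bands_mul_cap_mul_bands]
  calc _ = T.bands n (Finset.range p) * T.cabled n (cup i) * T.bands n (Finset.range (p + 2)) *
        (T.cabled n (cross e j) * T.bands n (Finset.range (p + 2))) * T.cabled n (cap i) := by
        simp only [mul_assoc]
    _ = T.cabled n (cup i) * (T.bands n (Finset.range (p + 2)) * T.bands n (Finset.range (p + 2))) *
        T.cabled n (cross e j) * T.cabled n (cap i) := by
        rw [bands_mul_cup_mul_bands, ← hX]; simp only [mul_assoc]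
    _ = _ := by rw [bands_mul_self]

theorem colored_curlRight {p i : ℕ} (e : Bool) (h : i < p) :
    T.colored n p [cup (i + 1), cross e i, cap (i + 1)] = curlScalar n e • T.colored n p [] := by
  have := T.band_mul_curlRight_eq n e i
  rw [colored_curl T n e h h.le (Or.inl rfl), colored_nil, ← T.bands_mul_band n h,
    mul_assoc (T.bands n _) (T.band n i)]
  rw [curlRight] at this
  rw [this, mul_smul_comm, smul_mul_assoc, bands_mul_band T n h, bands_mul_self]

theorem colored_curlLeft {p i : ℕ} (e : Bool) (h : i < p) :
    T.colored n p [cup i, cross e (i + 1), cap i] = curlScalar n e • T.colored n p [] := by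
  have := T.band_mul_curlLeft_eq n e i
  rw [colored_curl T n e h.le h (Or.inr rfl), colored_nil, ← T.bands_mul_band n h,
    mul_assoc (T.bands n _) (T.band n i)]
  rw [curlLeft] at this
  rw [this, mul_smul_comm, smul_mul_assoc, bands_mul_band T n h, bands_mul_self]

end TLRep

/-! ### Invariance of coloured tangles under local moves -/

namespace TLRep

variable {R : Type} [Ring R] [Algebra K R] (T : TLRep R) (n : ℕ)

theorem colored_pair_eq_pair {p q : ℕ} {s t s' t' : Slice} (h : IsTangle p [s, t] q)
    (h' : IsTangle p [s', t'] q) (hc : ∀ i, ¬(s = cup i ∧ t = cap i))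
    (hc' : ∀ i, ¬(s' = cup i ∧ t' = cap i))
    (heq : T.cabled n s * T.cabled n t = T.cabled n s' * T.cabled n t') :
    T.colored n p [s, t] = T.colored n p [s', t'] := by
  obtain ⟨hs, ht, rfl⟩ := h
  obtain ⟨hs', ht', h'⟩ := h'
  have h'' : p - s'.piece.inputs + s'.piece.outputs - t'.piece.inputs + t'.piece.outputs =
    p - s.piece.inputs + s.piece.outputs - t.piece.inputs + t.piece.outputs := h'
  rw [colored_pair T n hs ht hc, colored_pair T n hs' ht' hc', heq, h'']

theorem colored_pair_eq_nil {p : ℕ} {s t : Slice} (h : IsTangle p [s, t] p)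
    (hc : ∀ i, ¬(s = cup i ∧ t = cap i)) (heq : T.cabled n s * T.cabled n t = 1) :
    T.colored n p [s, t] = T.colored n p [] := by
  obtain ⟨hs, ht, h⟩ := h
  have h' : p - s.piece.inputs + s.piece.outputs - t.piece.inputs + t.piece.outputs = p := h
  rw [colored_pair T n hs ht hc, heq, h', mul_one, bands_mul_self, colored_nil]

theorem colored_type_III {p i : ℕ} (e : Bool) (h : i + 3 ≤ p) :
    T.colored n p [cross e i, cross e (i + 1), cross e i] =
      T.colored n p [cross e (i + 1), cross e i, cross e (i + 1)] := by
  have hp : p - 2 + 2 = p := by omega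
  have hcons : ∀ i w, i + 2 ≤ p → T.colored n p (cross e i :: w) =
      T.cabled n (cross e i) * T.colored n p w := by
    intro i w hi
    rw [colored_cons]
    change _ * T.colored n (p - 2 + 2) w = _
    rw [hp, bands_range_mul_cross T n hi, mul_assoc, bands_mul_colored]
  rw [hcons _ _ (by omega), hcons _ _ (by omega), hcons _ _ (by omega), hcons _ _ (by omega),
    hcons _ _ (by omega), hcons _ _ (by omega)]
  simp only [← mul_assoc, cabled_type_III]

theorem colored_eq_of_framedLocalMove {p q : ℕ} {l r : List Slice} (h : FramedLocalMove l r)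
    (hl : IsTangle p l q) (hr : IsTangle p r q) : T.colored n p l = T.colored n p r := by
  cases h with
  | independent g h i k =>
    refine T.colored_pair_eq_pair n hl hr ?_ ?_ (T.cabled_far n g h i k)
    · rintro j ⟨h1, h2⟩
      simp only [cup, cap, Slice.mk.injEq] at h1 h2
      obtain ⟨rfl, rfl⟩ := h1
      simp only [Piece.outputs] at h2
      omega
    · rintro j ⟨h1, h2⟩
      simp only [cup, cap, Slice.mk.injEq] at h1 h2
      obtain ⟨rfl, rfl⟩ := h2
      simp only [Piece.inputs] at h1
      omega
  | zigzag_left i =>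
    obtain rfl : p = q := hr
    refine T.colored_pair_eq_nil n hl ?_ (T.cabled_zigzag_left n i)
    rintro j ⟨h1, h2⟩
    simp only [cup, cap, Slice.mk.injEq, true_and] at h1 h2
    omega
  | zigzag_right i =>
    obtain rfl : p = q := hr
    refine T.colored_pair_eq_nil n hl ?_ (T.cabled_zigzag_right n i)
    rintro j ⟨h1, h2⟩
    simp only [cup, cap, Slice.mk.injEq, true_and] at h1 h2
    omega
  | turn_cup e i =>
    exact T.colored_pair_eq_pair n hl hr (by simp [cross, cap]) (by simp [cross, cap])
      (T.cabled_turn_cup n e i)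
  | turn_cap e i =>
    exact T.colored_pair_eq_pair n hl hr (by simp [cross, cup]) (by simp [cross, cup])
      (T.cabled_turn_cap n e i)
  | type_II e i =>
    obtain rfl : p = q := hr
    exact T.colored_pair_eq_nil n hl (by simp [cross, cup]) (T.cabled_type_II n e i)
  | type_III e i =>
    have := hr.1
    simp only [cross, Piece.inputs] at this
    exact T.colored_type_III n e (by omega)
  | type_I_framed e i =>
    have : i < p := hl.1
    rw [colored_curlRight T n e this, colored_curlLeft T n e this]

end TLRep

/-- A local move multiplies coloured tangles by a scalar. -/
theorem exists_colored_eq_smul (n : ℕ) {l r : List Slice} (h : AmbientLocalMove l r) :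
    ∃ a : K, a ≠ 0 ∧ ∀ (R : Type) [Ring R] [Algebra K R] (T : TLRep R) (p q : ℕ),
      IsTangle p l q → IsTangle p r q → T.colored n p l = a • T.colored n p r := by
  cases h with
  | framed h =>
    exact ⟨1, one_ne_zero, fun R _ _ T p q hl hr => by
      rw [one_smul, T.colored_eq_of_framedLocalMove n h hl hr]⟩
  | type_I_right e i =>
    exact ⟨_, curlScalar_ne_zero n e, fun R _ _ T p q hl hr => T.colored_curlRight n e hl.1⟩
  | type_I_left e i =>
    refine ⟨_, curlScalar_ne_zero n e, fun R _ _ T p q hl hr => T.colored_curlLeft n e ?_⟩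
    have := hl.2.1
    simp only [cross, cup, Piece.inputs, Piece.outputs] at this
    omega

/-- Used to see that both sides of a move made inside a diagram have the same end points. -/
theorem IsTangle.unique_left {p p' q : ℕ} {w : List Slice} (h : IsTangle p w q)
    (h' : IsTangle p' w q) : p = p' := by
  induction w generalizing p p' with
  | nil => exact h.trans h'.symm
  | cons s w ih =>
    have := ih h.2 h'.2
    have := h.1
    have := h'.1
    omega

/-! ### Coloured diagrams -/

theorem prod_mem_tangles {p : ℕ} {l : List Formal} (h : ∀ y ∈ l, y ∈ tangles p p) :
    l.prod ∈ tangles p p := by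
  induction l with
  | nil => exact one_mem_tangles p
  | cons y l ih =>
    rw [List.prod_cons]
    exact mul_mem_tangles (h y (by simp)) (ih fun y hy => h y (by simp [hy]))

theorem projectorRow_mem_tangles (n p : ℕ) : projectorRow n p ∈ tangles (n * p) (n * p) := by
  refine prod_mem_tangles fun y hy => ?_
  simp only [List.mem_map, List.mem_range] at hy
  obtain ⟨j, hj, rfl⟩ := hy
  obtain ⟨k, rfl⟩ := Nat.exists_eq_add_of_le (Nat.succ_le_of_lt hj)
  have := tangles_mono (TLRep.band_mem n j) (n * k)
  rwa [← mul_add] at this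

theorem coloredTangle_mem_tangles (n : ℕ) {p q : ℕ} {w : List Slice} (h : IsTangle p w q) :
    coloredTangle n p w ∈ tangles (n * p) (n * q) := by
  induction w generalizing p with
  | nil => obtain rfl : p = q := h; exact projectorRow_mem_tangles n p
  | cons s w ih =>
    exact mul_mem_tangles (mul_mem_tangles (projectorRow_mem_tangles n p)
      (ofWord_mem_tangles (isTangle_cable_slice h.1))) (ih h.2)

theorem skeinTrace_colored {t : K} (ht : t ≠ 0) (n : ℕ) (D : AnnularDiagram) :
    skeinTrace ht (D.colored n) =
      spinTrace t (n * D.width) (spinRep.colored n D.width D.word) := by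
  rw [AnnularDiagram.colored, closure_eq,
    skeinTrace_closureLin ht (coloredTangle_mem_tangles n D.closed), TLRep.colored]

/-- Compared under every `skeinTrace`: a local move acts on one factor of the coloured word in
`spinRep`, and a change of the cut is cyclicity of the trace. -/
theorem exists_colored_eq_smul_of_move (n : ℕ) {D D' : AnnularDiagram}
    (h : AnnularMove AmbientLocalMove D D') : ∃ a : K, a ≠ 0 ∧ D.colored n = a • D'.colored n := by
  cases h with
  | @in_place m u l r v hlr hl hr =>
    obtain ⟨a, ha, H⟩ := exists_colored_eq_smul n hlr
    refine ⟨a, ha, skein_ext fun t ht => ?_⟩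
    rw [map_smul, skeinTrace_colored, skeinTrace_colored, ← map_smul]
    congr 1
    obtain ⟨q, hul, hv⟩ := isTangle_append.1 hl
    obtain ⟨p, hu, hl'⟩ := isTangle_append.1 hul
    obtain ⟨q', hur, hv'⟩ := isTangle_append.1 hr
    obtain ⟨p', hu', hr'⟩ := isTangle_append.1 hur
    obtain rfl := hu.unique hu'
    obtain rfl := hv.unique_left hv'
    change spinRep.colored n m (u ++ l ++ v) = a • spinRep.colored n m (u ++ r ++ v)
    rw [TLRep.colored_append _ n hul, TLRep.colored_append _ n hu, TLRep.colored_append _ n hur,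
      TLRep.colored_append _ n hu, H _ spinRep p q hl' hr', mul_smul_comm, smul_mul_assoc]
  | @rotate m p u v hu hv h h' =>
    refine ⟨1, one_ne_zero, skein_ext fun t ht => ?_⟩
    rw [one_smul, skeinTrace_colored, skeinTrace_colored]
    change spinTrace t (n * m) (spinRep.colored n m (u ++ v)) =
      spinTrace t (n * p) (spinRep.colored n p (v ++ u))
    rw [TLRep.colored_append _ n hu, TLRep.colored_append _ n hv]
    exact spinTrace_mul_comm (eval_mem_homogeneous ht (coloredTangle_mem_tangles n hu))
      (eval_mem_homogeneous ht (coloredTangle_mem_tangles n hv))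

theorem exists_colored_eq_smul_of_ambientIsotopic (n : ℕ) {D D' : AnnularDiagram}
    (h : AmbientIsotopic D D') : ∃ a : K, a ≠ 0 ∧ D.colored n = a • D'.colored n := by
  induction h with
  | rel D D' h => exact exists_colored_eq_smul_of_move n h
  | refl D => exact ⟨1, one_ne_zero, (one_smul _ _).symm⟩
  | symm D D' _ ih =>
    obtain ⟨a, ha, h⟩ := ih
    exact ⟨a⁻¹, inv_ne_zero ha, by rw [h, smul_smul, inv_mul_cancel₀ ha, one_smul]⟩
  | trans D D' D'' _ _ ih ih' =>
    obtain ⟨a, ha, h⟩ := ih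
    obtain ⟨b, hb, h'⟩ := ih'
    exact ⟨a * b, mul_ne_zero ha hb, by rw [h, h', smul_smul]⟩

/-! ### Chebyshev expansions -/

theorem degree_S (n : ℕ) : (Polynomial.Chebyshev.S K (n : ℤ)).degree = n := by
  induction n using Nat.twoStepInduction with
  | zero => simp
  | one => simp
  | more n h0 h1 =>
    have h := Polynomial.Chebyshev.S_add_two K (n : ℤ)
    push_cast at *
    have h2 : (Polynomial.X * Polynomial.Chebyshev.S K ((n : ℤ) + 1)).degree = (n : WithBot ℕ) + 2 := by
      rw [Polynomial.degree_mul, h1, Polynomial.degree_X, add_comm, add_assoc]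
      rfl
    rw [h, Polynomial.degree_sub_eq_left_of_degree_lt, h2]
    rw [h0, h2]
    exact_mod_cast (show n < n + 2 by omega)

/-- The Chebyshev polynomials as a basis of the polynomials. -/
def chebyshevBasis : Module.Basis ℕ K (Polynomial K) :=
  Polynomial.Sequence.basis ⟨fun n => Polynomial.Chebyshev.S K (n : ℤ), degree_S⟩ fun _ =>
    isUnit_iff_ne_zero.2 (Polynomial.leadingCoeff_ne_zero.2 (Polynomial.Sequence.ne_zero _ _))

theorem chebyshevBasis_apply (n : ℕ) :
    chebyshevBasis n = Polynomial.Chebyshev.S K (n : ℤ) :=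
  Polynomial.Sequence.basis_eq_self _ _ n

theorem sum_chebyshevElement (Γ : ℕ →₀ K) :
    (Γ.sum fun i c => c • chebyshevElement i) = evalCore (chebyshevBasis.repr.symm Γ) := by
  rw [Module.Basis.repr_symm_apply, Finsupp.linearCombination_apply, Finsupp.sum, Finsupp.sum,
    map_sum]
  refine Finset.sum_congr rfl fun i _ => ?_
  rw [map_smul, chebyshevBasis_apply, evalCore_eq_sum]
  rfl

/-- The Chebyshev polynomials have one member in each degree and so form a basis of `K[z]`, and
`evalCore` is injective. -/
theorem sum_chebyshevElement_injective {Γ Γ' : ℕ →₀ K}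
    (h : (Γ.sum fun i c => c • chebyshevElement i) = Γ'.sum fun i c => c • chebyshevElement i) :
    Γ = Γ' := by
  rw [sum_chebyshevElement, sum_chebyshevElement] at h
  exact chebyshevBasis.repr.symm.injective (evalCore_injective h)

theorem existsUnique_chebyshevExpansion (n : ℕ) (D : AnnularDiagram) :
    ∃! Γ : ℕ →₀ K, IsChebyshevExpansion n D Γ := by
  obtain ⟨P, hP⟩ := evalCore_surjective (D.colored n)
  refine ⟨chebyshevBasis.repr P, ?_, fun Γ hΓ => sum_chebyshevElement_injective ?_⟩
  · change D.colored n = _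
    rw [sum_chebyshevElement, LinearEquiv.symm_apply_apply, hP]
  · rw [← show D.colored n = _ from hΓ, sum_chebyshevElement, LinearEquiv.symm_apply_apply, hP]

end

end AnnularSkein

/-! ### Proportional expansions have equal ratios. -/

theorem mainTheorem6 (n : ℕ) :
    (∀ D : AnnularSkein.AnnularDiagram,
      ∃! Γ : ℕ →₀ AnnularSkein.K, AnnularSkein.IsChebyshevExpansion n D Γ) ∧
    ∀ D D' : AnnularSkein.AnnularDiagram, AnnularSkein.AmbientIsotopic D D' →
      ∀ Γ Γ' : ℕ →₀ AnnularSkein.K,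
        AnnularSkein.IsChebyshevExpansion n D Γ → AnnularSkein.IsChebyshevExpansion n D' Γ' →
        ∀ k : ℕ, AnnularSkein.IsLastIndex Γ k →
          AnnularSkein.IsLastIndex Γ' k ∧ ∀ i : ℕ, i < k → Γ i / Γ k = Γ' i / Γ' k := by
  refine ⟨AnnularSkein.existsUnique_chebyshevExpansion n, fun D D' h Γ Γ' hΓ hΓ' k hk => ?_⟩
  obtain ⟨a, ha, hD⟩ := AnnularSkein.exists_colored_eq_smul_of_ambientIsotopic n h
  -- Uniqueness of the expansion turns proportionality of skein elements into proportionality of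
  -- coefficients; the common factor `a` then cancels in the ratios.
  have heq : Γ = a • Γ' := by
    refine AnnularSkein.sum_chebyshevElement_injective ?_
    rw [← show D.colored n = _ from hΓ, hD, show D'.colored n = _ from hΓ',
      AnnularSkein.sum_chebyshevElement, AnnularSkein.sum_chebyshevElement, map_smul, map_smul]
  subst heq
  simp only [AnnularSkein.IsLastIndex, Finsupp.smul_apply, smul_eq_mul] at hk ⊢
  refine ⟨⟨right_ne_zero_of_mul hk.1, fun i hi => ?_⟩, fun i _ => mul_div_mul_left _ _ ha⟩
  exact (mul_eq_zero.1 (hk.2 i hi)).resolve_left ha
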